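/- **Theorem.** Let $\mu={\rm Leb}_1\otimes{\rm P}$ on $\mathbb R\times[0,1]^{\mathbb N}$, where ${\rm P}$ is the law of a sequence of independent random variables uniformly distributed on $[0,1]$. Let $W$ be a Gaussian white noise with intensity measure $\mu$ on a probability space, that is, a centered Gaussian process $(W(A))$ indexed by the Borel sets $A$ with $\mu(A)<\infty$ such that $\mathbb E\,W(A)W(B)=\mu(A\cap B)$. For $l\in\mathbb N=\{1,2,\ldots\}$ let $W_l$ be the restriction of $W$ to $\mathbb R\times[0,1]^l$, that is, $W_l(A)=W(A\times[0,1]^{\mathbb N})$; it is a white noise whose intensity is Lebesgue measure. Integrals with respect to $W_l$ are the $L^2$-limits of integrals of elementary functions. Put $\psi_l(x)=\frac{x^l}{l!}e^{-x}$ for $l\in\mathbb N_0$ and $x\in\mathbb R$ and, for $u\in\mathbb R$ and $l\in\mathbb N$, $$Z_1(u)=-\int_{\mathbb R\times[0,1]}\Big(\mathbf 1_{\{y\le \exp(-e^{-(x-u)})\}}-\exp(-e^{-(x-u)})\Big)W_1({\rm d}x,{\rm d}y),$$ $$X_l(u)=\int_{\mathbb R\times[0,1]^{l+1}}\Big(\mathbf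 1_{\{y_1\cdots y_{l+1}<\psi_0(e^{-(x-u)})<y_1\cdots y_l\}}-\psi_l(e^{-(x-u)})\Big)W_{l+1}({\rm d}x,{\rm d}y_1,\ldots,{\rm d}y_{l+1}),$$ $$Z_l(u)=Z_1(u)-\sum_{k=1}^{l-1}X_k(u).$$ Then the processes $Z_l$, $l\in\mathbb N$, are jointly Gaussian, and for each $l\in\mathbb N$ the process $Z_l=(Z_l(u))_{u\in\mathbb R}$ is a centered (strictly) stationary Gaussian process with covariance $${\rm Cov}(Z_l(u),Z_l(v))=\log(1+e^{-|u-v|})-\sum_{k=1}^{l-1}\frac{(2k-1)!\,e^{-|u-v|k}}{(k!)^2(1+e^{-|u-v|})^{2k}},\quad u,v\in\mathbb R.$$ The cross-covariances are, for $l\in\mathbb N$, $n\in\mathbb N_0$ and $u,v\in\mathbb R$, $$\mathbb E Z_l(u)Z_{l+n}(v)=\log(1+e^{-|u-v|})-\sum_{k=1}^{l-1}\frac{(2k-1)!\,e^{-|u-v|k}}{(k!)^2(1+e^{-|u-v|})^{2k}}$$ $$\qquad+\sum_{r=0}^{n-1}\sum_{i=0}^{l-1}\Big(\frac1{l+r}\binom{l+r}{i}\big((1-e^{u-v})_+\big)^{l+r-i}e^{(u-v)i}-\frac1{l+r+i}\binom{l+r+i}{i}\frac{e^{(u-v)i}}{(1+e^{u-v})^{l+r+i}}\Big).$$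 Moreover, for each $l\in\mathbb N$ the process $Z_l$ has a version all of whose sample paths are, for every $\alpha\in(0,1/2)$, locally Hölder continuous with exponent $\alpha$, that is, Hölder continuous with exponent $\alpha$ on every compact interval. -/

import Mathlib

open MeasureTheory ProbabilityTheory Filter Topology

noncomputable section

/-! ### White noise and its integral -/

/-- A (real) Gaussian white noise with intensity measure `μ`, on the probability space `(Ω, P)`:
a centered Gaussian process indexed by the measurable sets of finite `μ`-measure, with covariance
`E[W(A) W(B)] = μ(A ∩ B)`. Only the values of `W` on such sets matter. -/
structure IsWhiteNoise {E Ω : Type*} [MeasurableSpace E] [MeasurableSpace Ω]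
    (W : Set E → Ω → ℝ) (μ : Measure E) (P : Measure Ω) : Prop where
  isGaussianProcess :
    IsGaussianProcess (fun A : {A : Set E // MeasurableSet A ∧ μ A < ⊤} => W A.1) P
  integral_eq_zero : ∀ A, MeasurableSet A → μ A < ⊤ → ∫ ω, W A ω ∂P = 0
  integral_mul : ∀ A B, MeasurableSet A → μ A < ⊤ → MeasurableSet B → μ B < ⊤ →
    ∫ ω, W A ω * W B ω ∂P = (μ (A ∩ B)).toReal

/-- A finite formal combination `∑ c_A · A` of measurable sets of finite measure; it encodes the
elementary integrand `∑ c_A 1_A`. -/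
def IsElementary {E : Type*} [MeasurableSpace E] (μ : Measure E) (φ : Set E →₀ ℝ) : Prop :=
  ∀ A ∈ φ.support, MeasurableSet A ∧ μ A < ⊤

/-- The elementary integrand `∑ c_A 1_A`. -/
def elementaryFun {E : Type*} (φ : Set E →₀ ℝ) (x : E) : ℝ :=
  φ.sum fun A c => c * A.indicator (fun _ => (1 : ℝ)) x

/-- The integral `∑ c_A W(A)` of the elementary integrand `∑ c_A 1_A`. -/
def elementaryIntegral {E Ω : Type*} (W : Set E → Ω → ℝ) (φ : Set E →₀ ℝ) (ω : Ω) : ℝ :=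
  φ.sum fun A c => c * W A ω

/-- The random variable `Y` is (a version of) the white-noise integral `∫ f dW`: for some sequence
of elementary integrands converging to `f` in `L²(μ)`, the elementary integrals converge to `Y` in
`L²(P)`. -/
def IsWhiteNoiseIntegral {E Ω : Type*} [MeasurableSpace E] [MeasurableSpace Ω]
    (W : Set E → Ω → ℝ) (μ : Measure E) (P : Measure Ω) (f : E → ℝ) (Y : Ω → ℝ) : Prop :=
  MemLp f 2 μ ∧ MemLp Y 2 P ∧ ∃ φ : ℕ → Set E →₀ ℝ, (∀ n, IsElementary μ (φ n)) ∧
    Tendsto (fun n => eLpNorm (fun x => elementaryFun (φ n) x - f x) 2 μ) atTop (𝓝 0) ∧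
    Tendsto (fun n => eLpNorm (fun ω => elementaryIntegral W (φ n) ω - Y ω) 2 P) atTop (𝓝 0)

/-! The integral exists for every square integrable integrand and is almost surely unique. -/

section WellDefined
set_option linter.unusedSectionVars false

variable {E Ω : Type*} [MeasurableSpace E] [MeasurableSpace Ω] {W : Set E → Ω → ℝ}
  {μ : Measure E} {P : Measure Ω}

theorem elementaryFun_sub (φ ψ : Set E →₀ ℝ) (x : E) :
    elementaryFun (φ - ψ) x = elementaryFun φ x - elementaryFun ψ x :=
  Finsupp.sum_sub_index fun _ _ _ => sub_mul _ _ _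

theorem elementaryIntegral_sub (φ ψ : Set E →₀ ℝ) (ω : Ω) :
    elementaryIntegral W (φ - ψ) ω = elementaryIntegral W φ ω - elementaryIntegral W ψ ω :=
  Finsupp.sum_sub_index fun _ _ _ => sub_mul _ _ _

theorem IsElementary.sub {φ ψ : Set E →₀ ℝ} (hφ : IsElementary μ φ) (hψ : IsElementary μ ψ) :
    IsElementary μ (φ - ψ) := by
  classical
  intro A hA
  rcases Finset.mem_union.1 (Finsupp.support_sub hA) with h | h
  exacts [hφ A h, hψ A h]

theorem IsWhiteNoise.memLp (hW : IsWhiteNoise W μ P) {A : Set E} (hA : MeasurableSet A)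
    (hA' : μ A < ⊤) : MemLp (W A) 2 P :=
  (hW.isGaussianProcess.hasGaussianLaw_eval ⟨A, hA, hA'⟩).memLp_two

theorem IsElementary.memLp_fun {φ : Set E →₀ ℝ} (hφ : IsElementary μ φ) :
    MemLp (elementaryFun φ) 2 μ := by
  have : elementaryFun φ = fun x => ∑ A ∈ φ.support, φ A * A.indicator (fun _ => (1 : ℝ)) x := rfl
  rw [this]
  refine memLp_finsetSum _ fun A hA => ?_
  exact (memLp_indicator_const 2 (hφ A hA).1 1 (Or.inr (hφ A hA).2.ne)).const_mul _

theorem IsElementary.memLp_integral (hW : IsWhiteNoise W μ P) {φ : Set E →₀ ℝ}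
    (hφ : IsElementary μ φ) : MemLp (elementaryIntegral W φ) 2 P := by
  have : elementaryIntegral W φ = fun ω => ∑ A ∈ φ.support, φ A * W A ω := rfl
  rw [this]
  exact memLp_finsetSum _ fun A hA => (hW.memLp (hφ A hA).1 (hφ A hA).2).const_mul _

/-- The elementary integral is an isometry. -/
theorem IsElementary.eLpNorm_eq (hW : IsWhiteNoise W μ P) {φ : Set E →₀ ℝ}
    (hφ : IsElementary μ φ) :
    eLpNorm (elementaryIntegral W φ) 2 P = eLpNorm (elementaryFun φ) 2 μ := by
  have key : ∫ ω, elementaryIntegral W φ ω ^ 2 ∂P = ∫ x, elementaryFun φ x ^ 2 ∂μ := by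
    have h1 : ∀ ω, elementaryIntegral W φ ω ^ 2 =
        ∑ A ∈ φ.support, ∑ B ∈ φ.support, φ A * φ B * (W A ω * W B ω) := by
      intro ω
      simp only [elementaryIntegral, Finsupp.sum, sq, Finset.sum_mul_sum]
      exact Finset.sum_congr rfl fun A _ => Finset.sum_congr rfl fun B _ => by ring
    have h2 : ∀ x, elementaryFun φ x ^ 2 = ∑ A ∈ φ.support, ∑ B ∈ φ.support,
        φ A * φ B * (A ∩ B).indicator (fun _ => (1 : ℝ)) x := by
      intro x
      simp only [elementaryFun, Finsupp.sum, sq, Finset.sum_mul_sum]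
      refine Finset.sum_congr rfl fun A _ => Finset.sum_congr rfl fun B _ => ?_
      by_cases ha : x ∈ A <;> by_cases hb : x ∈ B <;> simp [ha, hb]
    simp only [h1, h2]
    have i1 : ∀ A ∈ φ.support, ∀ B ∈ φ.support,
        Integrable (fun ω => φ A * φ B * (W A ω * W B ω)) P := fun A hA B hB =>
      ((hW.memLp (hφ A hA).1 (hφ A hA).2).integrable_mul
        (hW.memLp (hφ B hB).1 (hφ B hB).2)).const_mul _
    have i2 : ∀ A ∈ φ.support, ∀ B ∈ φ.support,
        Integrable (fun x => φ A * φ B * (A ∩ B).indicator (fun _ => (1 : ℝ)) x) μ :=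
      fun A hA B hB => ((integrable_indicator_iff ((hφ A hA).1.inter (hφ B hB).1)).2
        (integrableOn_const ((measure_mono Set.inter_subset_left).trans_lt
          (hφ A hA).2).ne)).const_mul _
    rw [integral_finsetSum _ fun A hA => integrable_finsetSum _ fun B hB => i1 A hA B hB,
      integral_finsetSum _ fun A hA => integrable_finsetSum _ fun B hB => i2 A hA B hB]
    refine Finset.sum_congr rfl fun A hA => ?_
    rw [integral_finsetSum _ fun B hB => i1 A hA B hB,
      integral_finsetSum _ fun B hB => i2 A hA B hB]
    refine Finset.sum_congr rfl fun B hB => ?_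
    rw [integral_const_mul, integral_const_mul,
      hW.integral_mul A B (hφ A hA).1 (hφ A hA).2 (hφ B hB).1 (hφ B hB).2,
      integral_indicator_const _ ((hφ A hA).1.inter (hφ B hB).1)]
    simp [Measure.real]
  rw [(hφ.memLp_integral hW).eLpNorm_eq_integral_rpow_norm two_ne_zero ENNReal.ofNat_ne_top,
    hφ.memLp_fun.eLpNorm_eq_integral_rpow_norm two_ne_zero ENNReal.ofNat_ne_top]
  simp [key]

/-- Every square integrable integrand has a white-noise integral. -/
theorem IsWhiteNoise.exists_integral (hW : IsWhiteNoise W μ P) {f : E → ℝ} (hf : MemLp f 2 μ) :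
    ∃ Y, IsWhiteNoiseIntegral W μ P f Y := by
  have happ : ∀ n : ℕ, ∃ φ : Set E →₀ ℝ, IsElementary μ φ ∧
      eLpNorm (f - elementaryFun φ) 2 μ ≤ ((n : ENNReal) + 1)⁻¹ := by
    intro n
    suffices h : ∃ g : E → ℝ, eLpNorm (f - g) 2 μ ≤ ((n : ENNReal) + 1)⁻¹ ∧
        ∃ φ : Set E →₀ ℝ, IsElementary μ φ ∧ g = elementaryFun φ by
      obtain ⟨g, hg, φ, hφ, rfl⟩ := h
      exact ⟨φ, hφ, hg⟩
    refine MemLp.induction_dense (by simp) _ ?_ ?_ ?_ hf (by simp)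
    · intro c s hs hs' ε _
      refine ⟨_, ?_, Finsupp.single s c, ?_, rfl⟩
      · have : elementaryFun (Finsupp.single s c) = s.indicator fun _ => c := by
          funext x
          by_cases hx : x ∈ s <;> simp [elementaryFun, hx]
        simp [this]
      · intro A hA
        obtain rfl : A = s := by
          simpa using Finsupp.support_single_subset hA
        exact ⟨hs, hs'⟩
    · rintro _ _ ⟨φ, hφ, rfl⟩ ⟨ψ, hψ, rfl⟩
      refine ⟨φ - (0 - ψ), hφ.sub (IsElementary.sub (by simp [IsElementary]) hψ), ?_⟩
      funext x
      simp only [Pi.add_apply, elementaryFun_sub]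
      simp [elementaryFun]
    · rintro _ ⟨φ, hφ, rfl⟩
      exact hφ.memLp_fun.aestronglyMeasurable
  choose φ hφ hle using happ
  have hlim : Tendsto (fun n => eLpNorm (elementaryFun (φ n) - f) 2 μ) atTop (𝓝 0) := by
    have h0 : Tendsto (fun n : ℕ => ((n : ENNReal) + 1)⁻¹) atTop (𝓝 0) := by
      have := ENNReal.tendsto_inv_nat_nhds_zero.comp (tendsto_add_atTop_nat 1)
      simpa [Function.comp_def] using this
    refine tendsto_of_tendsto_of_tendsto_of_le_of_le tendsto_const_nhds h0 (fun _ => zero_le)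
      fun n => ?_
    simpa only [eLpNorm_sub_comm] using hle n
  have hmem := fun n => (hφ n).memLp_integral hW
  have hc : CauchySeq fun n => (hφ n).memLp_fun.toLp _ := by
    refine Tendsto.cauchySeq (x := hf.toLp f) ?_
    rw [Lp.tendsto_Lp_iff_tendsto_eLpNorm'' _ (fun n => (hφ n).memLp_fun)]
    exact hlim
  have hc' : CauchySeq fun n => (hmem n).toLp _ := by
    rw [EMetric.cauchySeq_iff] at hc ⊢
    intro ε hε
    obtain ⟨N, hN⟩ := hc ε hε
    refine ⟨N, fun m hm n hn => ?_⟩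
    have h := hN m hm n hn
    rw [Lp.edist_toLp_toLp] at h ⊢
    have e1 : elementaryFun (φ m) - elementaryFun (φ n) = elementaryFun (φ m - φ n) :=
      funext fun x => (elementaryFun_sub _ _ x).symm
    have e2 : elementaryIntegral W (φ m) - elementaryIntegral W (φ n) =
        elementaryIntegral W (φ m - φ n) :=
      funext fun x => (elementaryIntegral_sub _ _ x).symm
    rw [e1] at h
    rwa [e2, IsElementary.eLpNorm_eq hW ((hφ m).sub (hφ n))]
  obtain ⟨Y, hY⟩ := cauchySeq_tendsto_of_complete hc'
  refine ⟨Y, hf, Lp.memLp Y, φ, hφ, hlim, ?_⟩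
  rw [← Lp.toLp_coeFn Y (Lp.memLp Y),
    Lp.tendsto_Lp_iff_tendsto_eLpNorm'' _ hmem] at hY
  exact hY

/-- The white-noise integral is almost surely unique. -/
theorem IsWhiteNoiseIntegral.ae_eq (hW : IsWhiteNoise W μ P) {f : E → ℝ} {Y Y' : Ω → ℝ}
    (h : IsWhiteNoiseIntegral W μ P f Y) (h' : IsWhiteNoiseIntegral W μ P f Y') : Y =ᵐ[P] Y' := by
  obtain ⟨hf, hY, φ, hφ, h1, h2⟩ := h
  obtain ⟨-, hY', ψ, hψ, h3, h4⟩ := h'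
  have hb : ∀ n, eLpNorm (Y - Y') 2 P ≤
      eLpNorm (fun ω => elementaryIntegral W (φ n) ω - Y ω) 2 P +
      ((eLpNorm (fun x => elementaryFun (φ n) x - f x) 2 μ +
        eLpNorm (fun x => elementaryFun (ψ n) x - f x) 2 μ) +
      eLpNorm (fun ω => elementaryIntegral W (ψ n) ω - Y' ω) 2 P) := by
    intro n
    have a1 := ((hφ n).memLp_integral hW).aestronglyMeasurable
    have a2 := ((hψ n).memLp_integral hW).aestronglyMeasurable
    have b1 := (hφ n).memLp_fun.aestronglyMeasurable
    have b2 := (hψ n).memLp_fun.aestronglyMeasurable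
    have e : Y - Y' = (Y - elementaryIntegral W (φ n)) +
        (elementaryIntegral W (φ n - ψ n) + (elementaryIntegral W (ψ n) - Y')) := by
      funext ω
      simp only [Pi.sub_apply, Pi.add_apply, elementaryIntegral_sub]
      ring
    have e' : elementaryFun (φ n - ψ n) =
        (elementaryFun (φ n) - f) + (f - elementaryFun (ψ n)) := by
      funext x
      simp only [Pi.sub_apply, Pi.add_apply, elementaryFun_sub]
      ring
    have hm := (((hφ n).sub (hψ n)).memLp_integral hW).aestronglyMeasurable
    rw [e]
    refine (eLpNorm_add_le (hY.aestronglyMeasurable.sub a1)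
      (hm.add (a2.sub hY'.aestronglyMeasurable)) (by norm_num)).trans ?_
    refine add_le_add (by rw [eLpNorm_sub_comm]; rfl) ?_
    refine (eLpNorm_add_le hm (a2.sub hY'.aestronglyMeasurable) (by norm_num)).trans ?_
    refine add_le_add ?_ le_rfl
    rw [((hφ n).sub (hψ n)).eLpNorm_eq hW, e']
    refine (eLpNorm_add_le (b1.sub hf.aestronglyMeasurable) (hf.aestronglyMeasurable.sub b2)
      (by norm_num)).trans ?_
    exact add_le_add le_rfl (by rw [eLpNorm_sub_comm]; rfl)
  have hz : eLpNorm (Y - Y') 2 P ≤ 0 := by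
    refine ge_of_tendsto' (x := atTop) ?_ hb
    simpa using h2.add ((h1.add h3).add h4)
  have := (eLpNorm_eq_zero_iff (hY.sub hY').aestronglyMeasurable two_ne_zero).1 (le_antisymm hz zero_le)
  filter_upwards [this] with ω hω
  exact sub_eq_zero.1 hω

end WellDefined

open Classical in
/-- The white-noise integral `∫ f dW`, an almost surely unique random variable (a version of it is
chosen; the value is `0` if `f` is not square integrable). -/
def whiteNoiseIntegral {E Ω : Type*} [MeasurableSpace E] [MeasurableSpace Ω]
    (W : Set E → Ω → ℝ) (μ : Measure E) (P : Measure Ω) (f : E → ℝ) : Ω → ℝ :=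
  if h : ∃ Y, IsWhiteNoiseIntegral W μ P f Y then h.choose else 0

theorem whiteNoiseIntegral_spec {E Ω : Type*} [MeasurableSpace E] [MeasurableSpace Ω]
    {W : Set E → Ω → ℝ} {μ : Measure E} {P : Measure Ω} (hW : IsWhiteNoise W μ P) {f : E → ℝ}
    (hf : MemLp f 2 μ) : IsWhiteNoiseIntegral W μ P f (whiteNoiseIntegral W μ P f) := by
  have h := hW.exists_integral hf
  rw [whiteNoiseIntegral, dif_pos h]
  exact h.choose_spec

/-! ### The processes -/

/-- The intensity measure `Leb₁ ⊗ P` on `ℝ × [0,1]^ℕ`, where `P` is the law of a sequence of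
independent random variables with the uniform distribution on `[0,1]`. -/
def intensity : Measure (ℝ × (ℕ → unitInterval)) :=
  (volume : Measure ℝ).prod (Measure.infinitePi fun _ : ℕ => (volume : Measure unitInterval))

/-- The restriction `W_l` of `W` to `ℝ × [0,1]^l`, namely `W_l(A) = W(A × [0,1]^ℕ)`. -/
def restrictNoise {Ω : Type*} (W : Set (ℝ × (ℕ → unitInterval)) → Ω → ℝ) (l : ℕ)
    (A : Set (ℝ × (Fin l → unitInterval))) : Ω → ℝ :=
  W {p | (p.1, fun i : Fin l => p.2 i) ∈ A}

/-- `ψ_l(x) = x^l e^{-x} / l!`; in particular `ψ_0(x) = e^{-x}`. -/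
def psi (l : ℕ) (x : ℝ) : ℝ := x ^ l / (l.factorial : ℝ) * Real.exp (-x)

/-- The integrand of `Z_1(u)`: `(x, y) ↦ 1{y ≤ exp(-e^{-(x-u)})} - exp(-e^{-(x-u)})` on
`ℝ × [0,1]`. -/
def kernelZ (u : ℝ) (p : ℝ × (Fin 1 → unitInterval)) : ℝ :=
  {q : ℝ × (Fin 1 → unitInterval) |
      (q.2 0 : ℝ) ≤ Real.exp (-Real.exp (-(q.1 - u)))}.indicator (fun _ => 1) p
    - Real.exp (-Real.exp (-(p.1 - u)))

/-- The integrand of `X_l(u)`: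
`(x, y) ↦ 1{y_1 ⋯ y_{l+1} < ψ_0(e^{-(x-u)}) < y_1 ⋯ y_l} - ψ_l(e^{-(x-u)})` on
`ℝ × [0,1]^{l+1}`. -/
def kernelX (l : ℕ) (u : ℝ) (p : ℝ × (Fin (l + 1) → unitInterval)) : ℝ :=
  {q : ℝ × (Fin (l + 1) → unitInterval) |
      ∏ i : Fin (l + 1), (q.2 i : ℝ) < psi 0 (Real.exp (-(q.1 - u))) ∧
      psi 0 (Real.exp (-(q.1 - u))) < ∏ i : Fin l, (q.2 i.castSucc : ℝ)}.indicator (fun _ => 1) p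
    - psi l (Real.exp (-(p.1 - u)))

/-- `X_l(u)`, the integral of `kernelX l u` with respect to `W_{l+1}`. -/
def procX {Ω : Type*} [MeasurableSpace Ω] (W : Set (ℝ × (ℕ → unitInterval)) → Ω → ℝ)
    (P : Measure Ω) (l : ℕ) (u : ℝ) : Ω → ℝ :=
  whiteNoiseIntegral (restrictNoise W (l + 1)) volume P (kernelX l u)

/-- `Z_1(u)`, minus the integral of `kernelZ u` with respect to `W_1`. -/
def procZOne {Ω : Type*} [MeasurableSpace Ω] (W : Set (ℝ × (ℕ → unitInterval)) → Ω → ℝ)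
    (P : Measure Ω) (u : ℝ) : Ω → ℝ :=
  fun ω => -whiteNoiseIntegral (restrictNoise W 1) volume P (kernelZ u) ω

/-- `Z_l(u) = Z_1(u) - ∑_{k=1}^{l-1} X_k(u)`, for `l ≥ 1`. -/
def procZ {Ω : Type*} [MeasurableSpace Ω] (W : Set (ℝ × (ℕ → unitInterval)) → Ω → ℝ)
    (P : Measure Ω) (l : ℕ) (u : ℝ) : Ω → ℝ :=
  fun ω => procZOne W P u ω - ∑ k ∈ Finset.Ico 1 l, procX W P k u ω

/-- Strict-sense stationarity: finite-dimensional distributions are invariant under shifts of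
time. -/
def IsStrictlyStationary {Ω : Type*} [MeasurableSpace Ω] (Z : ℝ → Ω → ℝ) (P : Measure Ω) : Prop :=
  ∀ (n : ℕ) (t : Fin n → ℝ) (h : ℝ),
    IdentDistrib (fun ω (i : Fin n) => Z (t i + h) ω) (fun ω (i : Fin n) => Z (t i) ω) P P

/-- The asserted covariance of `Z_l(u)` and `Z_l(v)`. -/
def covZ (l : ℕ) (u v : ℝ) : ℝ :=
  Real.log (1 + Real.exp (-|u - v|)) -
    ∑ k ∈ Finset.Ico 1 l, ((2 * k - 1).factorial : ℝ) * Real.exp (-|u - v| * k) /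
      ((k.factorial : ℝ) ^ 2 * (1 + Real.exp (-|u - v|)) ^ (2 * k))

/-- The asserted cross-covariance of `Z_l(u)` and `Z_{l+n}(v)`. -/
def crossCovZ (l n : ℕ) (u v : ℝ) : ℝ :=
  covZ l u v + ∑ r ∈ Finset.range n, ∑ i ∈ Finset.range l,
    (1 / ((l : ℝ) + r) * ((l + r).choose i : ℝ) * (max (1 - Real.exp (u - v)) 0) ^ (l + r - i) *
        Real.exp ((u - v) * i)
      - 1 / ((l : ℝ) + r + i) * ((l + r + i).choose i : ℝ) *
        (Real.exp ((u - v) * i) / (1 + Real.exp (u - v)) ^ (l + r + i)))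

end

/-! ### Linearity of elementary integrands and their integrals. -/

section Elementary

variable {E Ω : Type*} {W : Set E → Ω → ℝ}

/-! The white-noise integral is a linear isometry with centered Gaussian values, so each
distributional claim reduces to inner products of integrands. Pulled back to `ℝ × [0,1]^ℕ`, all
integrands live over one noise, and the inner products become integrals over `x` of covariances of
events in the sequence `y`.

Those events describe a Poisson process. For independent uniform `y_i`, the numbers `-log (y_1 ⋯
y_k)` are the arrival times of a unit-rate Poisson process. Writing the threshold as `exp (-t)` with
`t = e^{-(x-u)}`, `crossing k` says that exactly `k` arrivals occur before time `t`, and `below l`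
that fewer than `l` do. Their probabilities are `psi k t` and `∑_{k<l} psi k t`. Since `below (l+1)`
is the disjoint union of `below l` and `crossing l`, subtracting `X_l` from `Z_l` gives `Z_{l+1}`,
and `-Z_l(u)` is the integral of the centered indicator of `below l` (`tailKernel`,
`IsWhiteNoise.isIntegral_procZ`).

For fixed `l` the events at `u` and `v` are nested, so with `F = poissonTail l` the covariance is `∫
(min(F_u, F_v) - F_u F_v) dx`. It is computed by induction on `l` in
`integral_poissonTail_mul_one_sub`. The cross-covariances need in addition the joint law of the
Poisson counts at two times, which comes from independent increments (`uniformSeq_crossing_inter`).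
The covariance depends only on `u - v`, which gives stationarity through
`IsWhiteNoiseIntegral.identDistrib`.

The variance of an increment is `∫ (F_u - F_v) - (F_u - F_v)² dx ≤ |u - v|` for `u ≤ v`
(`covZ_increment_le`). Gaussian moments then bound the `2m`-th moment of the increment by a multiple
of `|u - v|^m` for every `m`, and the Kolmogorov–Chentsov argument (`exists_locally_holder_version`)
reaches every exponent below `1/2`. -/

theorem elementaryFun_add (φ ψ : Set E →₀ ℝ) (x : E) :
    elementaryFun (φ + ψ) x = elementaryFun φ x + elementaryFun ψ x := by
  classical
  exact Finsupp.sum_add_index' (fun _ => zero_mul _) fun _ _ _ => add_mul _ _ _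

theorem elementaryIntegral_add (φ ψ : Set E →₀ ℝ) (ω : Ω) :
    elementaryIntegral W (φ + ψ) ω = elementaryIntegral W φ ω + elementaryIntegral W ψ ω := by
  classical
  exact Finsupp.sum_add_index' (fun _ => zero_mul _) fun _ _ _ => add_mul _ _ _

theorem elementaryFun_smul (c : ℝ) (φ : Set E →₀ ℝ) (x : E) :
    elementaryFun (c • φ) x = c * elementaryFun φ x := by
  rw [elementaryFun, Finsupp.sum_smul_index' (fun _ => zero_mul _), elementaryFun, Finsupp.mul_sum]
  exact Finset.sum_congr rfl fun _ _ => by simp [mul_assoc]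

theorem elementaryIntegral_smul (c : ℝ) (φ : Set E →₀ ℝ) (ω : Ω) :
    elementaryIntegral W (c • φ) ω = c * elementaryIntegral W φ ω := by
  rw [elementaryIntegral, Finsupp.sum_smul_index' (fun _ => zero_mul _), elementaryIntegral,
    Finsupp.mul_sum]
  exact Finset.sum_congr rfl fun _ _ => by simp [mul_assoc]

end Elementary

/-! ### The white-noise integral: linearity, isometry, Gaussian laws. -/

section WhiteNoiseIntegral

variable {E Ω : Type*} [MeasurableSpace E] [MeasurableSpace Ω] {W : Set E → Ω → ℝ}
  {μ : Measure E} {P : Measure Ω}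

theorem IsElementary.add {φ ψ : Set E →₀ ℝ} (hφ : IsElementary μ φ) (hψ : IsElementary μ ψ) :
    IsElementary μ (φ + ψ) := by
  classical
  intro A hA
  rcases Finset.mem_union.1 (Finsupp.support_add hA) with h | h
  exacts [hφ A h, hψ A h]

theorem IsElementary.smul {φ : Set E →₀ ℝ} (hφ : IsElementary μ φ) (c : ℝ) :
    IsElementary μ (c • φ) :=
  fun A hA => hφ A (Finsupp.support_smul hA)

theorem isWhiteNoiseIntegral_zero : IsWhiteNoiseIntegral W μ P (fun _ => 0) fun _ => 0 := by
  refine ⟨MemLp.zero', MemLp.zero', fun _ => 0, fun _ => by simp [IsElementary], ?_, ?_⟩ <;>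
  simp [elementaryFun, elementaryIntegral]

theorem IsWhiteNoiseIntegral.add (hW : IsWhiteNoise W μ P) {f g : E → ℝ} {Y Z : Ω → ℝ}
    (h : IsWhiteNoiseIntegral W μ P f Y) (h' : IsWhiteNoiseIntegral W μ P g Z) :
    IsWhiteNoiseIntegral W μ P (fun x => f x + g x) fun ω => Y ω + Z ω := by
  obtain ⟨hf, hY, φ, hφ, h1, h2⟩ := h
  obtain ⟨hg, hZ, ψ, hψ, h3, h4⟩ := h'
  refine ⟨hf.add hg, hY.add hZ, fun n => φ n + ψ n, fun n => (hφ n).add (hψ n), ?_, ?_⟩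
  · refine tendsto_of_tendsto_of_tendsto_of_le_of_le tendsto_const_nhds
      (by simpa using h1.add h3) (fun _ => zero_le) fun n => ?_
    have e : (fun x => elementaryFun (φ n + ψ n) x - (f x + g x)) =
        (fun x => elementaryFun (φ n) x - f x) + fun x => elementaryFun (ψ n) x - g x := by
      funext x
      simp only [elementaryFun_add, Pi.add_apply]
      ring
    rw [e]
    exact eLpNorm_add_le ((hφ n).memLp_fun.aestronglyMeasurable.sub hf.aestronglyMeasurable)
      ((hψ n).memLp_fun.aestronglyMeasurable.sub hg.aestronglyMeasurable) (by norm_num)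
  · refine tendsto_of_tendsto_of_tendsto_of_le_of_le tendsto_const_nhds
      (by simpa using h2.add h4) (fun _ => zero_le) fun n => ?_
    have e : (fun ω => elementaryIntegral W (φ n + ψ n) ω - (Y ω + Z ω)) =
        (fun ω => elementaryIntegral W (φ n) ω - Y ω) +
          fun ω => elementaryIntegral W (ψ n) ω - Z ω := by
      funext x
      simp only [elementaryIntegral_add, Pi.add_apply]
      ring
    rw [e]
    exact eLpNorm_add_le (((hφ n).memLp_integral hW).aestronglyMeasurable.sub
        hY.aestronglyMeasurable)
      (((hψ n).memLp_integral hW).aestronglyMeasurable.sub hZ.aestronglyMeasurable) (by norm_num)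

theorem IsWhiteNoiseIntegral.const_mul {f : E → ℝ} {Y : Ω → ℝ}
    (h : IsWhiteNoiseIntegral W μ P f Y) (c : ℝ) :
    IsWhiteNoiseIntegral W μ P (fun x => c * f x) fun ω => c * Y ω := by
  obtain ⟨hf, hY, φ, hφ, h1, h2⟩ := h
  refine ⟨hf.const_mul c, hY.const_mul c, fun n => c • φ n, fun n => (hφ n).smul c, ?_, ?_⟩
  · have := ENNReal.Tendsto.const_mul h1 (Or.inr (enorm_ne_top (x := c)))
    rw [mul_zero] at this
    refine this.congr fun n => ?_
    rw [← eLpNorm_const_smul]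
    congr 1
    funext x
    simp [elementaryFun_smul, mul_sub]
  · have := ENNReal.Tendsto.const_mul h2 (Or.inr (enorm_ne_top (x := c)))
    rw [mul_zero] at this
    refine this.congr fun n => ?_
    rw [← eLpNorm_const_smul]
    congr 1
    funext x
    simp [elementaryIntegral_smul, mul_sub]

theorem IsWhiteNoiseIntegral.sum (hW : IsWhiteNoise W μ P) {ι : Type*} (s : Finset ι)
    {f : ι → E → ℝ} {Y : ι → Ω → ℝ} (h : ∀ i ∈ s, IsWhiteNoiseIntegral W μ P (f i) (Y i)) :
    IsWhiteNoiseIntegral W μ P (fun x => ∑ i ∈ s, f i x) fun ω => ∑ i ∈ s, Y i ω := by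
  classical
  induction s using Finset.induction_on with
  | empty => simpa using isWhiteNoiseIntegral_zero
  | insert a s ha ih =>
    simp only [Finset.sum_insert ha]
    exact (h a (by simp)).add hW (ih fun i hi => h i (by simp [hi]))

theorem IsWhiteNoiseIntegral.congr {f g : E → ℝ} {Y : Ω → ℝ}
    (h : IsWhiteNoiseIntegral W μ P f Y) (hfg : f =ᵐ[μ] g) :
    IsWhiteNoiseIntegral W μ P g Y := by
  obtain ⟨hf, hY, φ, hφ, h1, h2⟩ := h
  refine ⟨hf.ae_eq hfg, hY, φ, hφ, h1.congr fun n => eLpNorm_congr_ae ?_, h2⟩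
  filter_upwards [hfg] with x hx
  rw [hx]

/-- The integral with respect to the image of a noise under a measure preserving map. -/
theorem IsWhiteNoiseIntegral.comp_measurePreserving {E' : Type*} [MeasurableSpace E']
    {ν : Measure E'} {π : E → E'} (hπ : MeasurePreserving π μ ν) {f : E' → ℝ} {Y : Ω → ℝ}
    (h : IsWhiteNoiseIntegral (fun A => W (π ⁻¹' A)) ν P f Y) :
    IsWhiteNoiseIntegral W μ P (fun x => f (π x)) Y := by
  classical
  obtain ⟨hf, hY, φ, hφ, h1, h2⟩ := h
  have e1 : ∀ n x, elementaryFun ((φ n).mapDomain (π ⁻¹' ·)) x = elementaryFun (φ n) (π x) := by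
    intro n x
    rw [elementaryFun, Finsupp.sum_mapDomain_index (by simp) (by intros; ring)]
    rfl
  have e2 : ∀ n ω, elementaryIntegral W ((φ n).mapDomain (π ⁻¹' ·)) ω =
      elementaryIntegral (fun A => W (π ⁻¹' A)) (φ n) ω := by
    intro n x
    rw [elementaryIntegral, Finsupp.sum_mapDomain_index (by simp) (by intros; ring)]
    rfl
  refine ⟨hf.comp_measurePreserving hπ, hY, fun n => (φ n).mapDomain (π ⁻¹' ·), ?_, ?_, ?_⟩
  · intro n A hA
    obtain ⟨B, hB, rfl⟩ := Finset.mem_image.1 (Finsupp.mapDomain_support hA)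
    refine ⟨hπ.measurable (hφ n B hB).1, ?_⟩
    rw [hπ.measure_preimage (hφ n B hB).1.nullMeasurableSet]
    exact (hφ n B hB).2
  · refine h1.congr fun n => ?_
    simp only [e1]
    exact (eLpNorm_comp_measurePreserving ((hφ n).memLp_fun.aestronglyMeasurable.sub
      hf.aestronglyMeasurable) hπ).symm
  · simpa only [e2] using h2

theorem IsWhiteNoise.map {E' : Type*} [MeasurableSpace E'] (hW : IsWhiteNoise W μ P)
    {ν : Measure E'} {π : E → E'} (hπ : MeasurePreserving π μ ν) :
    IsWhiteNoise (fun A => W (π ⁻¹' A)) ν P := by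
  have key : ∀ A, MeasurableSet A → ν A < ⊤ → MeasurableSet (π ⁻¹' A) ∧ μ (π ⁻¹' A) < ⊤ := by
    intro A hA hA'
    exact ⟨hπ.measurable hA, by rwa [hπ.measure_preimage hA.nullMeasurableSet]⟩
  refine ⟨?_, fun A hA hA' => hW.integral_eq_zero _ (key A hA hA').1 (key A hA hA').2,
    fun A B hA hA' hB hB' => ?_⟩
  · exact hW.isGaussianProcess.comp_right
      (fun A : {A : Set E' // MeasurableSet A ∧ ν A < ⊤} => ⟨π ⁻¹' A.1, key A.1 A.2.1 A.2.2⟩)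
  · rw [hW.integral_mul _ _ (key A hA hA').1 (key A hA hA').2 (key B hB hB').1 (key B hB hB').2,
      ← Set.preimage_inter, hπ.measure_preimage (hA.inter hB).nullMeasurableSet]

theorem IsElementary.integral_eq_zero (hW : IsWhiteNoise W μ P) {φ : Set E →₀ ℝ}
    (hφ : IsElementary μ φ) [IsFiniteMeasure P] : ∫ ω, elementaryIntegral W φ ω ∂P = 0 := by
  simp only [elementaryIntegral, Finsupp.sum]
  rw [integral_finsetSum]
  · refine Finset.sum_eq_zero fun A hA => ?_
    rw [integral_const_mul, hW.integral_eq_zero A (hφ A hA).1 (hφ A hA).2, mul_zero]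
  · exact fun A hA => ((hW.memLp (hφ A hA).1 (hφ A hA).2).integrable (by norm_num)).const_mul _

theorem IsElementary.hasGaussianLaw (hW : IsWhiteNoise W μ P) {φ : Set E →₀ ℝ}
    (hφ : IsElementary μ φ) : HasGaussianLaw (elementaryIntegral W φ) P := by
  classical
  have h := (hW.isGaussianProcess.comp_right
    (fun A : φ.support => ⟨A.1, hφ A.1 A.2⟩)).smul (fun A => φ A.1)
  have := h.hasGaussianLaw_fun_sum (I := Finset.univ)
  have e : elementaryIntegral W φ = fun ω => ∑ A : φ.support, φ A * W A ω :=
    funext fun ω => (Finset.sum_coe_sort φ.support (fun A => φ A * W A ω)).symm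
  rw [e]
  exact this

theorem integral_sq_eq_eLpNorm {f : E → ℝ} (hf : MemLp f 2 μ) :
    ∫ x, f x ^ 2 ∂μ = (eLpNorm f 2 μ).toReal ^ 2 := by
  have h := hf.eLpNorm_eq_integral_rpow_norm two_ne_zero ENNReal.ofNat_ne_top
  have h0 : 0 ≤ ∫ x, f x ^ 2 ∂μ := integral_nonneg fun x => sq_nonneg _
  rw [h, ENNReal.toReal_ofReal (by positivity)]
  simp only [ENNReal.toReal_ofNat, Real.norm_eq_abs, Real.rpow_ofNat, sq_abs]
  rw [inv_eq_one_div, ← Real.sqrt_eq_rpow, Real.sq_sqrt h0]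

theorem tendsto_eLpNorm_of_sub {f : ℕ → E → ℝ} {g : E → ℝ} (hf : ∀ n, MemLp (f n) 2 μ)
    (hg : MemLp g 2 μ) (h : Tendsto (fun n => eLpNorm (fun x => f n x - g x) 2 μ) atTop (𝓝 0)) :
    Tendsto (fun n => eLpNorm (f n) 2 μ) atTop (𝓝 (eLpNorm g 2 μ)) := by
  have h1 := (Lp.tendsto_Lp_iff_tendsto_eLpNorm'' f hf g hg).2 h
  have h2 := h1.enorm
  simpa only [Lp.enorm_toLp] using h2

/-- The white-noise integral is an isometry. -/
theorem IsWhiteNoiseIntegral.integral_sq (hW : IsWhiteNoise W μ P) {f : E → ℝ} {Y : Ω → ℝ}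
    (h : IsWhiteNoiseIntegral W μ P f Y) : ∫ ω, Y ω ^ 2 ∂P = ∫ x, f x ^ 2 ∂μ := by
  obtain ⟨hf, hY, φ, hφ, h1, h2⟩ := h
  have a := tendsto_eLpNorm_of_sub (fun n => (hφ n).memLp_fun) hf h1
  have b := tendsto_eLpNorm_of_sub (fun n => (hφ n).memLp_integral hW) hY h2
  simp only [fun n => (hφ n).eLpNorm_eq hW] at b
  rw [integral_sq_eq_eLpNorm hf, integral_sq_eq_eLpNorm hY, tendsto_nhds_unique a b]

/-- The white-noise integral has the centered Gaussian distribution with variance `∫ f²`. -/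
theorem IsWhiteNoiseIntegral.map_eq [IsProbabilityMeasure P] (hW : IsWhiteNoise W μ P)
    {f : E → ℝ} {Y : Ω → ℝ} (h : IsWhiteNoiseIntegral W μ P f Y) :
    P.map Y = gaussianReal 0 (∫ x, f x ^ 2 ∂μ).toNNReal := by
  have hsq := h.integral_sq hW
  obtain ⟨hf, hY, φ, hφ, h1, h2⟩ := h
  have hmem := fun n => (hφ n).memLp_integral hW
  have hv : Tendsto (fun n => ∫ ω, elementaryIntegral W (φ n) ω ^ 2 ∂P) atTop
      (𝓝 (∫ ω, Y ω ^ 2 ∂P)) := by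
    simp only [integral_sq_eq_eLpNorm hY, fun n => integral_sq_eq_eLpNorm (hmem n)]
    exact ((ENNReal.tendsto_toReal hY.eLpNorm_ne_top).comp
      (tendsto_eLpNorm_of_sub hmem hY h2)).pow 2
  -- Along an almost surely convergent subsequence the characteristic functions converge by
  -- dominated convergence. Convergence of the variances identifies the limit as Gaussian.
  obtain ⟨ns, hns, hae⟩ := (tendstoInMeasure_of_tendsto_eLpNorm two_ne_zero
    (fun n => (hmem n).aestronglyMeasurable) hY.aestronglyMeasurable h2).exists_seq_tendsto_ae
  have : IsProbabilityMeasure (P.map Y) :=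
    Measure.isProbabilityMeasure_map hY.aestronglyMeasurable.aemeasurable
  refine Measure.ext_of_charFun ?_
  funext t
  have hchar : ∀ n, charFun (P.map (elementaryIntegral W (φ n))) t =
      Complex.exp (-((∫ ω, elementaryIntegral W (φ n) ω ^ 2 ∂P : ℝ) : ℂ) * t ^ 2 / 2) := by
    intro n
    rw [((hφ n).hasGaussianLaw hW).map_eq_gaussianReal, charFun_gaussianReal]
    rw [(hφ n).integral_eq_zero hW, variance_eq_sub (hmem n), (hφ n).integral_eq_zero hW,
      Real.coe_toNNReal _ (by
        simp only [ne_eq, OfNat.ofNat_ne_zero, not_false_eq_true, zero_pow, sub_zero]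
        exact integral_nonneg fun _ => sq_nonneg _)]
    simp
    ring_nf
  have l1 : Tendsto (fun n => charFun (P.map (elementaryIntegral W (φ (ns n)))) t) atTop
      (𝓝 (charFun (P.map Y) t)) := by
    simp only [charFun_apply_real]
    have e : ∀ {X : Ω → ℝ}, AEStronglyMeasurable X P →
        ∫ x : ℝ, Complex.exp (t * x * Complex.I) ∂(P.map X) =
          ∫ ω, Complex.exp (t * X ω * Complex.I) ∂P := fun hX =>
      integral_map hX.aemeasurable (by fun_prop)
    simp only [e hY.aestronglyMeasurable, fun n => e (hmem n).aestronglyMeasurable]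
    refine tendsto_integral_of_dominated_convergence (fun _ => 1) (fun n => ?_)
      (integrable_const _) (fun n => ?_) ?_
    · have := (hmem (ns n)).aestronglyMeasurable
      have c : Continuous fun x : ℝ => Complex.exp (t * x * Complex.I) := by fun_prop
      exact c.comp_aestronglyMeasurable this
    · refine Eventually.of_forall fun ω => ?_
      rw [← Complex.ofReal_mul, Complex.norm_exp_ofReal_mul_I]
    · filter_upwards [hae] with ω hω
      have c : Continuous fun x : ℝ => Complex.exp (t * x * Complex.I) := by fun_prop
      exact (c.tendsto _).comp hω
  have l2 : Tendsto (fun n => charFun (P.map (elementaryIntegral W (φ (ns n)))) t) atTop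
      (𝓝 (Complex.exp (-((∫ ω, Y ω ^ 2 ∂P : ℝ) : ℂ) * t ^ 2 / 2))) := by
    simp only [hchar]
    have c : Continuous fun x : ℝ => Complex.exp (-(x : ℂ) * t ^ 2 / 2) := by fun_prop
    exact (c.tendsto _).comp (hv.comp hns.tendsto_atTop)
  rw [tendsto_nhds_unique l1 l2, charFun_gaussianReal, hsq,
    Real.coe_toNNReal _ (integral_nonneg fun _ => sq_nonneg _)]
  simp
  ring_nf

theorem IsWhiteNoiseIntegral.integral_eq_zero [IsProbabilityMeasure P] (hW : IsWhiteNoise W μ P)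
    {f : E → ℝ} {Y : Ω → ℝ} (h : IsWhiteNoiseIntegral W μ P f Y) : ∫ ω, Y ω ∂P = 0 := by
  have e := integral_map (f := fun x : ℝ => x) h.2.1.aestronglyMeasurable.aemeasurable
    (by fun_prop)
  rw [← e, h.map_eq hW, integral_id_gaussianReal]

theorem integral_add_sq {f g : E → ℝ} (hf : MemLp f 2 μ) (hg : MemLp g 2 μ) :
    ∫ x, (f x + g x) ^ 2 ∂μ =
      ∫ x, f x ^ 2 ∂μ + 2 * ∫ x, f x * g x ∂μ + ∫ x, g x ^ 2 ∂μ := by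
  have i1 := hf.integrable_sq
  have i2 := hg.integrable_sq
  have i3 : Integrable (fun x => 2 * (f x * g x)) μ := (hf.integrable_mul hg).const_mul 2
  have i4 : Integrable (fun x => f x ^ 2 + 2 * (f x * g x)) μ := i1.add i3
  rw [← integral_const_mul, ← integral_add i1 i3, ← integral_add i4 i2]
  refine integral_congr_ae (Eventually.of_forall fun x => ?_)
  ring

/-- Polarization of the isometry: compare the two expansions of the square of a sum. -/
theorem IsWhiteNoiseIntegral.integral_mul (hW : IsWhiteNoise W μ P)
    {f g : E → ℝ} {Y Z : Ω → ℝ} (h : IsWhiteNoiseIntegral W μ P f Y)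
    (h' : IsWhiteNoiseIntegral W μ P g Z) : ∫ ω, Y ω * Z ω ∂P = ∫ x, f x * g x ∂μ := by
  have e := (h.add hW h').integral_sq hW
  rw [integral_add_sq h.2.1 h'.2.1, integral_add_sq h.1 h'.1, h.integral_sq hW, h'.integral_sq hW] at e
  linarith

/-- The Cramér–Wold ingredient: a linear functional of several integrals is again a white-noise
integral, by linearity. Joint Gaussianity and equality of joint laws both follow from it. -/
theorem IsWhiteNoiseIntegral.map_dual [IsProbabilityMeasure P] (hW : IsWhiteNoise W μ P)
    {ι : Type*} [Fintype ι] [DecidableEq ι] {f : ι → E → ℝ} {Y : ι → Ω → ℝ}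
    (h : ∀ i, IsWhiteNoiseIntegral W μ P (f i) (Y i)) (L : (ι → ℝ) →L[ℝ] ℝ) :
    P.map (fun ω => L fun i => Y i ω) =
      gaussianReal 0 (∫ x, (∑ i, L (Pi.single i 1) * f i x) ^ 2 ∂μ).toNNReal := by
  have hL : ∀ v : ι → ℝ, L v = ∑ i, L (Pi.single i 1) * v i := by
    intro v
    conv_lhs => rw [← Finset.univ_sum_single v]
    rw [map_sum]
    refine Finset.sum_congr rfl fun i _ => ?_
    have : (Pi.single i (v i) : ι → ℝ) = v i • Pi.single i 1 := by
      rw [← Pi.single_smul]; simp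
    rw [this, map_smul, smul_eq_mul, mul_comm]
  have e : (fun ω => L fun i => Y i ω) = fun ω => ∑ i, L (Pi.single i 1) * Y i ω :=
    funext fun ω => hL _
  rw [e]
  exact (IsWhiteNoiseIntegral.sum hW Finset.univ fun i _ => (h i).const_mul _).map_eq hW

theorem IsWhiteNoiseIntegral.isGaussianProcess [IsProbabilityMeasure P] (hW : IsWhiteNoise W μ P)
    {ι : Type*} {f : ι → E → ℝ} {Y : ι → Ω → ℝ}
    (h : ∀ i, IsWhiteNoiseIntegral W μ P (f i) (Y i)) : IsGaussianProcess Y P := by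
  classical
  refine ⟨fun I => ⟨isGaussian_of_map_eq_gaussianReal fun L =>
    ⟨0, (∫ x, (∑ i : I, L (Pi.single i 1) * f i x) ^ 2 ∂μ).toNNReal, ?_⟩⟩⟩
  have hm : AEMeasurable (fun ω => I.restrict (Y · ω)) P :=
    aemeasurable_pi_lambda _ fun i => (h i).2.1.aestronglyMeasurable.aemeasurable
  rw [AEMeasurable.map_map_of_aemeasurable L.continuous.aemeasurable hm]
  exact IsWhiteNoiseIntegral.map_dual hW (fun i : I => h i) L

/-- The joint distribution of white-noise integrals only depends on the inner products of the
integrands. -/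
theorem IsWhiteNoiseIntegral.identDistrib [IsProbabilityMeasure P] (hW : IsWhiteNoise W μ P)
    {ι : Type*} [Fintype ι] {f g : ι → E → ℝ} {Y Z : ι → Ω → ℝ}
    (hY : ∀ i, IsWhiteNoiseIntegral W μ P (f i) (Y i))
    (hZ : ∀ i, IsWhiteNoiseIntegral W μ P (g i) (Z i))
    (hfg : ∀ i j, ∫ x, f i x * f j x ∂μ = ∫ x, g i x * g j x ∂μ) :
    IdentDistrib (fun ω i => Y i ω) (fun ω i => Z i ω) P P := by
  classical
  have mY : AEMeasurable (fun ω i => Y i ω) P :=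
    aemeasurable_pi_lambda _ fun i => (hY i).2.1.aestronglyMeasurable.aemeasurable
  have mZ : AEMeasurable (fun ω i => Z i ω) P :=
    aemeasurable_pi_lambda _ fun i => (hZ i).2.1.aestronglyMeasurable.aemeasurable
  refine ⟨mY, mZ, ?_⟩
  have := Measure.isProbabilityMeasure_map mY
  have := Measure.isProbabilityMeasure_map mZ
  refine Measure.ext_of_charFunDual ?_
  funext L
  rw [charFunDual_eq_charFun_map_one, charFunDual_eq_charFun_map_one,
    AEMeasurable.map_map_of_aemeasurable L.continuous.aemeasurable mY,
    AEMeasurable.map_map_of_aemeasurable L.continuous.aemeasurable mZ]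
  have gram : ∀ {F : ι → E → ℝ}, (∀ i, MemLp (F i) 2 μ) →
      ∫ x, (∑ i, L (Pi.single i 1) * F i x) ^ 2 ∂μ = ∑ i, ∑ j,
        L (Pi.single i 1) * L (Pi.single j 1) * ∫ x, F i x * F j x ∂μ := by
    intro F hF
    have : ∀ i j, Integrable (fun x => L (Pi.single i 1) * L (Pi.single j 1) * (F i x * F j x)) μ :=
      fun i j => ((hF i).integrable_mul (hF j)).const_mul _
    simp only [← integral_const_mul]
    simp only [← integral_finsetSum _ fun j _ => this _ j]
    rw [← integral_finsetSum _ fun i _ => integrable_finsetSum _ fun j _ => this i j]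
    refine integral_congr_ae (Eventually.of_forall fun x => ?_)
    simp only [sq, Finset.sum_mul_sum]
    exact Finset.sum_congr rfl fun i _ => Finset.sum_congr rfl fun j _ => by ring
  have e1 := IsWhiteNoiseIntegral.map_dual hW hY L
  have e2 := IsWhiteNoiseIntegral.map_dual hW hZ L
  rw [gram fun i => (hY i).1] at e1
  rw [gram fun i => (hZ i).1] at e2
  simp only [← hfg] at e2
  simp only [Function.comp_def]
  rw [e1, e2]

end WhiteNoiseIntegral

/-! ### Integrals over the line of distribution functions and Poisson weights. -/

noncomputable section

theorem integrable_of_hasDerivAt_of_nonneg {g g' : ℝ → ℝ} {m n : ℝ}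
    (hg : ∀ x, HasDerivAt g (g' x) x) (hpos : ∀ x, 0 ≤ g' x) (hbot : Tendsto g atBot (𝓝 m))
    (htop : Tendsto g atTop (𝓝 n)) : Integrable g' := by
  have hm : Measurable g' := by
    have : g' = deriv g := funext fun x => (hg x).deriv.symm
    rw [this]
    exact measurable_deriv g
  have h1 : IntegrableOn g' (Set.Ioi 0) :=
    integrableOn_Ioi_deriv_of_nonneg' (fun x _ => hg x) (fun x _ => hpos x) htop
  have h2 : IntegrableOn (fun x => g' (-x)) (Set.Ioi 0) := by
    -- The left half-line is reduced to the right one by the reflection `x ↦ -x`.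
    have := integrableOn_Ioi_deriv_of_nonneg' (a := 0) (g := fun x => -g (-x))
      (g' := fun x => g' (-x)) (fun x _ => by
        have := ((hg (-x)).scomp x (hasDerivAt_neg x)).neg
        simpa [Function.comp_def] using! this) (fun x _ => hpos _)
      ((hbot.comp tendsto_neg_atTop_atBot).neg)
    exact this
  have h3 : IntegrableOn g' (Set.Iic 0) := by
    rw [integrableOn_Iic_iff_integrableOn_Iio]
    rw [← neg_zero] at h2
    simpa using h2.comp_neg_Iio
  rw [← integrableOn_univ, ← Set.Iic_union_Ioi (a := (0 : ℝ))]
  exact h3.union h1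

theorem integral_eq_of_hasDerivAt_of_nonneg {g g' : ℝ → ℝ} {m n : ℝ}
    (hg : ∀ x, HasDerivAt g (g' x) x) (hpos : ∀ x, 0 ≤ g' x) (hbot : Tendsto g atBot (𝓝 m))
    (htop : Tendsto g atTop (𝓝 n)) : Integrable g' ∧ ∫ x, g' x = n - m := by
  have h := integrable_of_hasDerivAt_of_nonneg hg hpos hbot htop
  exact ⟨h, integral_of_hasDerivAt_of_tendsto hg h hbot htop⟩

/-- The integral of the difference of two translates of a distribution function. -/
theorem integral_translate_sub {h : ℝ → ℝ} (hc : Continuous h) (hmono : Monotone h)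
    (hbot : Tendsto h atBot (𝓝 0)) (htop : Tendsto h atTop (𝓝 1)) {v w : ℝ} (hvw : v ≤ w) :
    Integrable (fun x => h (x - v) - h (x - w)) ∧ ∫ x, (h (x - v) - h (x - w)) = w - v := by
  have hint : ∀ a b, IntervalIntegrable h volume a b := fun a b => hc.intervalIntegrable a b
  have hG : ∀ y, HasDerivAt (fun y => ∫ t in (0:ℝ)..y, h t) (h y) y := fun y =>
    intervalIntegral.integral_hasDerivAt_right (hint 0 y)
      (hc.stronglyMeasurableAtFilter _ _) hc.continuousAt
  -- The integrand is the derivative of the integral of `h` over the sliding window `[x - w, x -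
  -- v]`. By monotonicity of `h` this is squeezed between `w - v` times the values of `h` at the two
  -- ends of the window, which gives its limits `0` and `w - v`.
  have hH : ∀ x, HasDerivAt (fun x => ∫ t in (x - w)..(x - v), h t) (h (x - v) - h (x - w)) x := by
    intro x
    have e : (fun x => ∫ t in (x - w)..(x - v), h t) =
        fun x => (∫ t in (0:ℝ)..(x - v), h t) - ∫ t in (0:ℝ)..(x - w), h t :=
      funext fun x => (intervalIntegral.integral_interval_sub_left (hint _ _) (hint _ _)).symm
    rw [e]
    exact ((hG (x - v)).comp_sub_const x v).sub ((hG (x - w)).comp_sub_const x w)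
  have hlow : ∀ x, (w - v) * h (x - w) ≤ ∫ t in (x - w)..(x - v), h t := by
    intro x
    have := intervalIntegral.integral_mono_on (a := x - w) (b := x - v) (by linarith)
      (intervalIntegrable_const (c := h (x - w)) (μ := volume)) (hint _ _)
      (fun t ht => hmono ht.1)
    simpa using this
  have hup : ∀ x, ∫ t in (x - w)..(x - v), h t ≤ (w - v) * h (x - v) := by
    intro x
    have := intervalIntegral.integral_mono_on (a := x - w) (b := x - v) (by linarith) (hint _ _)
      (intervalIntegrable_const (c := h (x - v)) (μ := volume)) (fun t ht => hmono ht.2)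
    simpa using this
  have sb : ∀ c : ℝ, Tendsto (fun x => x - c) atBot atBot := fun c =>
    tendsto_atBot_add_const_right _ (-c) tendsto_id
  have st : ∀ c : ℝ, Tendsto (fun x => x - c) atTop atTop := fun c =>
    tendsto_atTop_add_const_right _ (-c) tendsto_id
  have key := integral_eq_of_hasDerivAt_of_nonneg hH
    (fun x => sub_nonneg.2 (hmono (by linarith))) (m := 0) (n := w - v) ?_ ?_
  · simpa using key
  · refine tendsto_of_tendsto_of_tendsto_of_le_of_le ?_ ?_ hlow hup
    · simpa using (hbot.comp (sb w)).const_mul (w - v)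
    · simpa using (hbot.comp (sb v)).const_mul (w - v)
  · refine tendsto_of_tendsto_of_tendsto_of_le_of_le ?_ ?_ hlow hup
    · simpa using (htop.comp (st w)).const_mul (w - v)
    · simpa using (htop.comp (st v)).const_mul (w - v)

/-! ### Poisson weights along the exponential scale -/

/-- The Poisson weight `ψ_l(e^{-(x-u)})`. -/
def poissonTerm (l : ℕ) (u x : ℝ) : ℝ := psi l (Real.exp (-(x - u)))

/-- The Poisson tail `∑_{k<l} ψ_k(e^{-(x-u)})`. -/
def poissonTail (l : ℕ) (u x : ℝ) : ℝ := ∑ k ∈ Finset.range l, poissonTerm k u x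

theorem psi_nonneg (l : ℕ) {t : ℝ} (ht : 0 ≤ t) : 0 ≤ psi l t := by
  unfold psi; positivity

theorem continuous_psi (l : ℕ) : Continuous (psi l) := by
  unfold psi; fun_prop

theorem mul_psi (l : ℕ) (t : ℝ) : t * psi l t = (l + 1) * psi (l + 1) t := by
  have : (l.factorial : ℝ) ≠ 0 := by positivity
  have : (l + 1 : ℝ) ≠ 0 := by positivity
  rw [psi, psi, Nat.factorial_succ]
  push_cast
  field_simp
  ring

theorem hasDerivAt_psi_zero (t : ℝ) : HasDerivAt (psi 0) (-psi 0 t) t := by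
  have e : psi 0 = fun x => Real.exp (-x) := funext fun x => by simp [psi]
  rw [e]
  simpa using (hasDerivAt_neg t).exp

theorem hasDerivAt_psi_succ (l : ℕ) (t : ℝ) :
    HasDerivAt (psi (l + 1)) (psi l t - psi (l + 1) t) t := by
  have := ((hasDerivAt_pow (l + 1) t).div_const ((l + 1).factorial : ℝ)).mul (hasDerivAt_neg t).exp
  refine this.congr_deriv ?_
  have : (l.factorial : ℝ) ≠ 0 := by positivity
  have : (l + 1 : ℝ) ≠ 0 := by positivity
  rw [psi, psi, Nat.factorial_succ]
  push_cast
  field_simp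
  ring

theorem hasDerivAt_sum_psi (l : ℕ) (t : ℝ) :
    HasDerivAt (fun t => ∑ k ∈ Finset.range (l + 1), psi k t) (-psi l t) t := by
  induction l with
  | zero => simpa using hasDerivAt_psi_zero t
  | succ l ih =>
    simp only [Finset.sum_range_succ _ (l + 1)]
    exact (ih.add (hasDerivAt_psi_succ l t)).congr_deriv (by ring)

theorem sum_psi_le_one (l : ℕ) {t : ℝ} (ht : 0 ≤ t) : ∑ k ∈ Finset.range l, psi k t ≤ 1 := by
  have h := Real.sum_le_exp_of_nonneg ht l
  have : ∑ k ∈ Finset.range l, psi k t =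
      (∑ k ∈ Finset.range l, t ^ k / (k.factorial : ℝ)) * Real.exp (-t) := by
    simp only [psi, Finset.sum_mul]
  rw [this]
  calc _ ≤ Real.exp t * Real.exp (-t) := by gcongr
    _ = 1 := by rw [← Real.exp_add]; simp

theorem tendsto_psi_atTop (l : ℕ) : Tendsto (psi l) atTop (𝓝 0) := by
  have := (Real.tendsto_pow_mul_exp_neg_atTop_nhds_zero l).div_const (l.factorial : ℝ)
  rw [zero_div] at this
  refine this.congr fun t => ?_
  rw [psi]; ring

theorem psi_zero_right (l : ℕ) : psi l 0 = if l = 0 then 1 else 0 := by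
  by_cases h : l = 0 <;> simp [psi, h]

theorem tendsto_exp_neg_sub_atTop (u : ℝ) :
    Tendsto (fun x : ℝ => Real.exp (-(x - u))) atTop (𝓝 0) :=
  Real.tendsto_exp_atBot.comp
    (tendsto_neg_atTop_atBot.comp (tendsto_atTop_add_const_right _ (-u) tendsto_id))

theorem tendsto_exp_neg_sub_atBot (u : ℝ) :
    Tendsto (fun x : ℝ => Real.exp (-(x - u))) atBot atTop :=
  Real.tendsto_exp_atTop.comp
    (tendsto_neg_atBot_atTop.comp (tendsto_atBot_add_const_right _ (-u) tendsto_id))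

theorem poissonTerm_nonneg (l : ℕ) (u x : ℝ) : 0 ≤ poissonTerm l u x :=
  psi_nonneg l (Real.exp_pos _).le

theorem poissonTail_nonneg (l : ℕ) (u x : ℝ) : 0 ≤ poissonTail l u x :=
  Finset.sum_nonneg fun _ _ => poissonTerm_nonneg _ _ _

theorem poissonTail_le_one (l : ℕ) (u x : ℝ) : poissonTail l u x ≤ 1 :=
  sum_psi_le_one l (Real.exp_pos _).le

theorem poissonTail_succ (l : ℕ) (u x : ℝ) :
    poissonTail (l + 1) u x = poissonTail l u x + poissonTerm l u x :=
  Finset.sum_range_succ _ _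

theorem poissonTail_one (u x : ℝ) : poissonTail 1 u x = Real.exp (-Real.exp (-(x - u))) := by
  simp [poissonTail, poissonTerm, psi]

theorem continuous_poissonTerm (l : ℕ) (u : ℝ) : Continuous (poissonTerm l u) :=
  (continuous_psi l).comp (by fun_prop)

theorem continuous_poissonTail (l : ℕ) (u : ℝ) : Continuous (poissonTail l u) :=
  continuous_finsetSum _ fun k _ => continuous_poissonTerm k u

/-- With `t = e^{-(x-u)}`, the `t`-derivative of the sum telescopes to `-psi (l-1) t`. Since `dt/dx
= -t`, the chain rule gives `t * psi (l-1) t = l * psi l t`. -/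
theorem hasDerivAt_poissonTail (l : ℕ) (u x : ℝ) :
    HasDerivAt (poissonTail l u) (l * poissonTerm l u x) x := by
  cases l with
  | zero =>
    have : poissonTail 0 u = fun _ => 0 := funext fun x => by simp [poissonTail]
    simpa [this] using hasDerivAt_const x (0 : ℝ)
  | succ l =>
    have h1 : HasDerivAt (fun x => Real.exp (-(x - u))) (-Real.exp (-(x - u))) x := by
      have := ((hasDerivAt_id x).sub_const u).neg.exp
      simpa using! this
    have := (hasDerivAt_sum_psi l (Real.exp (-(x - u)))).comp x h1
    refine this.congr_deriv ?_
    rw [poissonTerm, Nat.cast_succ, ← mul_psi]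
    ring

theorem poissonTail_monotone (l : ℕ) (u : ℝ) : Monotone (poissonTail l u) :=
  monotone_of_hasDerivAt_nonneg (hasDerivAt_poissonTail l u) fun x =>
    mul_nonneg l.cast_nonneg (poissonTerm_nonneg l u x)

theorem poissonTail_eq_translate (l : ℕ) (u x : ℝ) :
    poissonTail l u x = poissonTail l 0 (x - u) := by
  simp [poissonTail, poissonTerm]

theorem poissonTail_antitone (l : ℕ) (x : ℝ) : Antitone fun u => poissonTail l u x := by
  intro u v h
  simp only [poissonTail_eq_translate l u, poissonTail_eq_translate l v]
  exact poissonTail_monotone l 0 (by linarith)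

theorem tendsto_poissonTail_atTop {l : ℕ} (hl : 1 ≤ l) (u : ℝ) :
    Tendsto (poissonTail l u) atTop (𝓝 1) := by
  have h : Tendsto (fun x => ∑ k ∈ Finset.range l, poissonTerm k u x) atTop
      (𝓝 (∑ k ∈ Finset.range l, psi k 0)) :=
    tendsto_finsetSum _ fun k _ => ((continuous_psi k).tendsto 0).comp (tendsto_exp_neg_sub_atTop u)
  have e : ∑ k ∈ Finset.range l, psi k 0 = 1 := by
    simp only [psi_zero_right, Finset.sum_ite_eq', Finset.mem_range]
    simp; omega
  rwa [e] at h

theorem tendsto_poissonTail_atBot (l : ℕ) (u : ℝ) :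
    Tendsto (poissonTail l u) atBot (𝓝 0) := by
  have h : Tendsto (fun x => ∑ k ∈ Finset.range l, poissonTerm k u x) atBot
      (𝓝 (∑ k ∈ Finset.range l, 0)) :=
    tendsto_finsetSum _ fun k _ => (tendsto_psi_atTop k).comp (tendsto_exp_neg_sub_atBot u)
  simpa using! h

theorem integral_poissonTerm {l : ℕ} (hl : 1 ≤ l) (u : ℝ) :
    Integrable (poissonTerm l u) ∧ ∫ x, poissonTerm l u x = 1 / l := by
  have hl0 : (l : ℝ) ≠ 0 := by positivity
  obtain ⟨h1, h2⟩ := integral_eq_of_hasDerivAt_of_nonneg (hasDerivAt_poissonTail l u)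
    (fun x => mul_nonneg l.cast_nonneg (poissonTerm_nonneg l u x)) (tendsto_poissonTail_atBot l u)
    (tendsto_poissonTail_atTop hl u)
  refine ⟨?_, ?_⟩
  · have := h1.const_mul (l : ℝ)⁻¹
    simpa [← mul_assoc, hl0] using! this
  · rw [integral_const_mul] at h2
    field_simp
    linarith

/-- The two Poisson parameters add up to `(e^u + e^v) e^{-x}`, which is the parameter for the shift
`log (e^u + e^v)`. A product of weights is therefore a constant times a single weight, whose
integral is known. -/
theorem poissonTerm_mul (i m : ℕ) (u v x : ℝ) :
    poissonTerm i u x * poissonTerm m v x =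
      ((i + m).factorial : ℝ) / (i.factorial * m.factorial) *
        (Real.exp u ^ i * Real.exp v ^ m / (Real.exp u + Real.exp v) ^ (i + m)) *
        poissonTerm (i + m) (Real.log (Real.exp u + Real.exp v)) x := by
  have hp : 0 < Real.exp u + Real.exp v := by positivity
  have e : ∀ a : ℝ, Real.exp (-(x - a)) = Real.exp a * Real.exp (-x) := fun a => by
    rw [← Real.exp_add]; ring_nf
  simp only [poissonTerm, psi, e, Real.exp_log hp, mul_pow]
  have e2 : Real.exp (-((Real.exp u + Real.exp v) * Real.exp (-x))) =
      Real.exp (-(Real.exp u * Real.exp (-x))) * Real.exp (-(Real.exp v * Real.exp (-x))) := by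
    rw [← Real.exp_add]; ring_nf
  rw [e2]
  have h1 : (i.factorial : ℝ) ≠ 0 := by positivity
  have h2 : (m.factorial : ℝ) ≠ 0 := by positivity
  have h3 : ((i + m).factorial : ℝ) ≠ 0 := by positivity
  generalize Real.exp (-(Real.exp u * Real.exp (-x))) = A
  generalize Real.exp (-(Real.exp v * Real.exp (-x))) = B
  have h4 := hp.ne'
  field_simp
  ring

theorem integral_poissonTerm_mul {i m : ℕ} (him : 1 ≤ i + m) (u v : ℝ) :
    Integrable (fun x => poissonTerm i u x * poissonTerm m v x) ∧
      ∫ x, poissonTerm i u x * poissonTerm m v x =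
        ((i + m - 1).factorial : ℝ) / (i.factorial * m.factorial) *
          (Real.exp u ^ i * Real.exp v ^ m / (Real.exp u + Real.exp v) ^ (i + m)) := by
  obtain ⟨h1, h2⟩ := integral_poissonTerm him (Real.log (Real.exp u + Real.exp v))
  simp only [poissonTerm_mul]
  refine ⟨h1.const_mul _, ?_⟩
  rw [integral_const_mul, h2]
  obtain ⟨k, hk⟩ : ∃ k, i + m = k + 1 := ⟨i + m - 1, by omega⟩
  rw [hk, Nat.factorial_succ]
  have : ((k : ℝ) + 1) ≠ 0 := by positivity
  push_cast
  field_simp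

/-- Up to the factor `l` the integrand is the derivative of the product of the two tails, which
increases from `0` to `1`. -/
theorem integral_poissonTail_mul_term {l : ℕ} (hl : 1 ≤ l) (u v : ℝ) :
    Integrable (fun x => poissonTerm l u x * poissonTail l v x +
        poissonTail l u x * poissonTerm l v x) ∧
      ∫ x, (poissonTerm l u x * poissonTail l v x + poissonTail l u x * poissonTerm l v x)
        = 1 / l := by
  have hl0 : (l : ℝ) ≠ 0 := by positivity
  have hd : ∀ x, HasDerivAt (fun x => poissonTail l u x * poissonTail l v x)
      (l * (poissonTerm l u x * poissonTail l v x + poissonTail l u x * poissonTerm l v x)) x :=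
    fun x => ((hasDerivAt_poissonTail l u x).mul (hasDerivAt_poissonTail l v x)).congr_deriv
      (by ring)
  obtain ⟨h1, h2⟩ := integral_eq_of_hasDerivAt_of_nonneg hd
    (fun x => mul_nonneg l.cast_nonneg (add_nonneg
      (mul_nonneg (poissonTerm_nonneg l u x) (poissonTail_nonneg l v x))
      (mul_nonneg (poissonTail_nonneg l u x) (poissonTerm_nonneg l v x))))
    ((tendsto_poissonTail_atBot l u).mul (tendsto_poissonTail_atBot l v))
    ((tendsto_poissonTail_atTop hl u).mul (tendsto_poissonTail_atTop hl v))
  refine ⟨?_, ?_⟩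
  · have := h1.const_mul (l : ℝ)⁻¹
    simpa [← mul_assoc, hl0] using! this
  · rw [integral_const_mul] at h2
    field_simp
    linarith

theorem integral_poissonTail_sub {l : ℕ} (hl : 1 ≤ l) {u v : ℝ} (huv : u ≤ v) :
    Integrable (fun x => poissonTail l u x - poissonTail l v x) ∧
      ∫ x, (poissonTail l u x - poissonTail l v x) = v - u := by
  have := integral_translate_sub (continuous_poissonTail l 0) (poissonTail_monotone l 0)
    (tendsto_poissonTail_atBot l 0) (tendsto_poissonTail_atTop hl 0) huv
  simpa only [← poissonTail_eq_translate] using this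

theorem covZ_succ {l : ℕ} (hl : 1 ≤ l) (u v : ℝ) :
    covZ (l + 1) u v = covZ l u v - ((2 * l - 1).factorial : ℝ) * Real.exp (-|u - v| * l) /
      ((l.factorial : ℝ) ^ 2 * (1 + Real.exp (-|u - v|)) ^ (2 * l)) := by
  rw [covZ, covZ, Finset.sum_Ico_succ_top hl]
  ring

/-- For `l = 1` the product of the two Gumbel distribution functions is the Gumbel function shifted
by `w = log (e^u + e^v)`, so the integral is `w - v`. In passing from `l` to `l + 1`, the two
contributions `1 / l` cancel, namely the integral of the new weight and that of the mixed terms.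
Only the integral of the product of two weights remains, and this is the new summand of `covZ`. -/
theorem integral_poissonTail_mul_one_sub {l : ℕ} (hl : 1 ≤ l) {u v : ℝ} (huv : u ≤ v) :
    Integrable (fun x => poissonTail l v x - poissonTail l u x * poissonTail l v x) ∧
      ∫ x, (poissonTail l v x - poissonTail l u x * poissonTail l v x) = covZ l u v := by
  have habs : -|u - v| = u - v := by rw [abs_of_nonpos (by linarith)]; ring
  induction l, hl using Nat.le_induction with
  | base =>
    set w := Real.log (Real.exp u + Real.exp v) with hw
    have hpos : 0 < Real.exp u + Real.exp v := by positivity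
    have e : ∀ x, poissonTail 1 u x * poissonTail 1 v x = poissonTail 1 w x := by
      intro x
      simp only [poissonTail_one, ← Real.exp_add]
      congr 1
      rw [show -(x - w) = w + -x by ring, Real.exp_add, hw, Real.exp_log hpos, add_mul,
        ← Real.exp_add, ← Real.exp_add]
      ring_nf
    have hvw : v ≤ w := by
      rw [hw, Real.le_log_iff_exp_le hpos]
      linarith [Real.exp_pos u]
    simp only [e]
    refine ⟨(integral_poissonTail_sub le_rfl hvw).1, ?_⟩
    rw [(integral_poissonTail_sub le_rfl hvw).2, covZ, habs]
    simp only [Finset.Ico_self, Finset.sum_empty, sub_zero]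
    rw [sub_eq_iff_eq_add, hw]
    conv_rhs => rw [← Real.log_exp v, ← Real.log_mul (by positivity) (by positivity)]
    rw [Real.log_exp, add_mul, ← Real.exp_add]
    ring_nf
  | succ l hl ih =>
    obtain ⟨i1, e1⟩ := integral_poissonTerm hl v
    obtain ⟨i2, e2⟩ := integral_poissonTail_mul_term hl u v
    obtain ⟨i3, e3⟩ := integral_poissonTerm_mul (i := l) (m := l) (by omega) u v
    obtain ⟨i4, e4⟩ := ih
    have e : ∀ x, poissonTail (l + 1) v x - poissonTail (l + 1) u x * poissonTail (l + 1) v x =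
        (poissonTail l v x - poissonTail l u x * poissonTail l v x) + poissonTerm l v x
        - (poissonTerm l u x * poissonTail l v x + poissonTail l u x * poissonTerm l v x)
        - poissonTerm l u x * poissonTerm l v x := by
      intro x
      simp only [poissonTail_succ]
      ring
    simp only [e]
    have i5 := i4.add i1
    have i6 := i5.sub i2
    refine ⟨i6.sub i3, ?_⟩
    rw [integral_sub (by exact i6) i3, integral_sub (by exact i5) i2, integral_add i4 i1, e1, e2,
      e3, e4, covZ_succ hl, habs]
    have h2 : (2 : ℕ) * l = l + l := by ring
    rw [h2]
    have hexp : Real.exp ((u - v) * l) = Real.exp u ^ l / Real.exp v ^ l := by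
      rw [← Real.exp_nat_mul, ← Real.exp_nat_mul, ← Real.exp_sub]; ring_nf
    have hs : 1 + Real.exp (u - v) = (Real.exp u + Real.exp v) / Real.exp v := by
      rw [Real.exp_sub]; field_simp; ring
    rw [hexp, hs, div_pow]
    have := Real.exp_pos u
    have := Real.exp_pos v
    have : Real.exp u + Real.exp v ≠ 0 := by positivity
    field_simp
    ring

theorem integral_min_poissonTail {l : ℕ} (hl : 1 ≤ l) (u v : ℝ) :
    Integrable (fun x => min (poissonTail l u x) (poissonTail l v x) -
        poissonTail l u x * poissonTail l v x) ∧
      ∫ x, (min (poissonTail l u x) (poissonTail l v x) -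
        poissonTail l u x * poissonTail l v x) = covZ l u v := by
  rcases le_total u v with h | h
  · simpa only [min_eq_right (poissonTail_antitone l _ h)] using
      integral_poissonTail_mul_one_sub hl h
  · have := integral_poissonTail_mul_one_sub hl h
    have e : covZ l v u = covZ l u v := by simp only [covZ, abs_sub_comm v u]
    simpa only [min_eq_left (poissonTail_antitone l _ h), e,
      mul_comm (poissonTail l v _)] using this

/-- The sum in front of `poissonTerm m v x` does not depend on `x`. It is the conditional
probability of fewer than `l` arrivals at the time belonging to `u`, given `m` arrivals at the time
belonging to `v`, see `uniformSeq_below_inter_crossing_threshold`. -/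
theorem integral_crossTerm {l m : ℕ} (hm : 1 ≤ m) (u v : ℝ) :
    Integrable (fun x => (∑ i ∈ Finset.range l, (m.choose i : ℝ) *
        (max (1 - Real.exp (u - v)) 0) ^ (m - i) * Real.exp ((u - v) * i)) * poissonTerm m v x
        - poissonTail l u x * poissonTerm m v x) ∧
    ∫ x, ((∑ i ∈ Finset.range l, (m.choose i : ℝ) *
        (max (1 - Real.exp (u - v)) 0) ^ (m - i) * Real.exp ((u - v) * i)) * poissonTerm m v x
        - poissonTail l u x * poissonTerm m v x) =
      ∑ i ∈ Finset.range l, (1 / (m : ℝ) * (m.choose i : ℝ) *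
        (max (1 - Real.exp (u - v)) 0) ^ (m - i) * Real.exp ((u - v) * i)
      - 1 / ((m : ℝ) + i) * ((m + i).choose i : ℝ) *
        (Real.exp ((u - v) * i) / (1 + Real.exp (u - v)) ^ (m + i))) := by
  obtain ⟨i1, e1⟩ := integral_poissonTerm hm v
  have h2 := fun i : ℕ => integral_poissonTerm_mul (i := i) (m := m) (by omega) u v
  simp only [poissonTail, Finset.sum_mul]
  have i3 : Integrable (fun x => ∑ i ∈ Finset.range l, poissonTerm i u x * poissonTerm m v x) :=
    integrable_finsetSum _ fun i _ => (h2 i).1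
  have i4 := fun c : ℝ => i1.const_mul c
  have i5 : Integrable (fun x => ∑ i ∈ Finset.range l, (m.choose i : ℝ) *
      (max (1 - Real.exp (u - v)) 0) ^ (m - i) * Real.exp ((u - v) * i) * poissonTerm m v x) :=
    integrable_finsetSum _ fun i _ => i4 _
  refine ⟨i5.sub i3, ?_⟩
  rw [integral_sub i5 i3, integral_finsetSum _ fun i _ => i4 _,
    integral_finsetSum _ fun i _ => (h2 i).1, ← Finset.sum_sub_distrib]
  refine Finset.sum_congr rfl fun i _ => ?_
  rw [(h2 i).2, integral_const_mul, e1]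
  congr 1
  · ring
  have hexp : Real.exp ((u - v) * i) = Real.exp u ^ i / Real.exp v ^ i := by
    rw [← Real.exp_nat_mul, ← Real.exp_nat_mul, ← Real.exp_sub]; ring_nf
  have hs : 1 + Real.exp (u - v) = (Real.exp u + Real.exp v) / Real.exp v := by
    rw [Real.exp_sub]; field_simp; ring
  rw [hexp, hs, div_pow, Nat.add_choose, Nat.cast_div (Nat.factorial_mul_factorial_dvd_factorial_add m i)
    (by positivity)]
  obtain ⟨k, rfl⟩ : ∃ k, m = k + 1 := ⟨m - 1, by omega⟩
  rw [show i + (k + 1) - 1 = k + i by omega, show k + 1 + i = (k + i) + 1 by omega,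
    show i + (k + 1) = (k + i) + 1 by omega, Nat.factorial_succ (k + i)]
  have := Real.exp_pos u
  have := Real.exp_pos v
  have : Real.exp u + Real.exp v ≠ 0 := by positivity
  push_cast
  have : (k : ℝ) + i + 1 ≠ 0 := by positivity
  have : (k : ℝ) + 1 + i ≠ 0 := by positivity
  field_simp
  ring

end

/-! ### Partial products of uniform variables as a Poisson process. -/

noncomputable section

/-- The law of a sequence of independent uniform random variables. -/
def uniformSeq : Measure (ℕ → unitInterval) :=
  Measure.infinitePi fun _ : ℕ => (volume : Measure unitInterval)

instance : IsProbabilityMeasure uniformSeq := by unfold uniformSeq; infer_instance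

/-- Prepending a first term to a sequence. -/
def consSeq (p : unitInterval × (ℕ → unitInterval)) : ℕ → unitInterval :=
  fun n => Nat.casesOn n p.1 p.2

@[simp] theorem consSeq_zero (p : unitInterval × (ℕ → unitInterval)) : consSeq p 0 = p.1 := rfl

@[simp] theorem consSeq_succ (p : unitInterval × (ℕ → unitInterval)) (n : ℕ) :
    consSeq p (n + 1) = p.2 n := rfl

theorem measurable_consSeq : Measurable consSeq := by
  refine measurable_pi_lambda _ fun n => ?_
  cases n with
  | zero => exact measurable_fst
  | succ n => exact (measurable_pi_apply n).comp measurable_snd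

/-- Makes the recursion on the first factor possible: a sequence is split into its first term and an
independent sequence with the same law. It suffices to check cylinder sets. -/
theorem measurePreserving_consSeq :
    MeasurePreserving consSeq ((volume : Measure unitInterval).prod uniformSeq) uniformSeq := by
  refine ⟨measurable_consSeq, ?_⟩
  refine Measure.eq_infinitePi _ fun s t ht => ?_
  have hs : ∀ (s : Finset ℕ) (t : ℕ → Set unitInterval), (∀ i, MeasurableSet (t i)) → 0 ∈ s → (volume.prod uniformSeq).map consSeq (Set.pi s t) =
      ∏ i ∈ s, (volume : Measure unitInterval) (t i) := by
    intro s t ht h0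
    have hpre : consSeq ⁻¹' (Set.pi s t) =
        t 0 ×ˢ Set.pi (s.preimage Nat.succ Nat.succ_injective.injOn) (fun n => t (n + 1)) := by
      ext p
      simp only [Set.mem_preimage, Set.mem_pi, Finset.mem_coe, Set.mem_prod, Finset.mem_preimage]
      constructor
      · exact fun h => ⟨h 0 h0, fun i hi => h (i + 1) hi⟩
      · rintro ⟨h1, h2⟩ i hi
        cases i with
        | zero => exact h1
        | succ i => exact h2 i hi
    rw [Measure.map_apply measurable_consSeq (MeasurableSet.pi s.countable_toSet fun i _ => ht i),
      hpre, Measure.prod_prod, uniformSeq, Measure.infinitePi_pi _ fun i _ => ht (i + 1)]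
    have : s = insert 0 ((s.preimage Nat.succ Nat.succ_injective.injOn).image Nat.succ) := by
      ext i
      cases i <;> simp [h0]
    conv_rhs => rw [this]
    rw [Finset.prod_insert (by simp), Finset.prod_image Nat.succ_injective.injOn]
  classical
  by_cases h0 : 0 ∈ s
  · exact hs s t ht h0
  -- A cylinder that does not constrain coordinate `0` is given the trivial constraint `Set.univ`
  -- there.
  · have h := hs (insert 0 s) (Function.update t 0 Set.univ) (fun i => by
      by_cases hi : i = 0
      · subst hi; simp
      · simpa [hi] using ht i) (by simp)
    have hne : ∀ i ∈ s, i ≠ 0 := fun i hi hi0 => h0 (hi0 ▸ hi)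
    have e1 : Set.pi (insert 0 s : Finset ℕ) (Function.update t 0 Set.univ) = Set.pi s t := by
      ext y
      simp only [Set.mem_pi, Finset.mem_coe, Finset.mem_insert]
      constructor
      · intro hy i hi
        simpa [hne i hi] using hy i (Or.inr hi)
      · rintro hy i (rfl | hi)
        · simp
        · simpa [hne i hi] using hy i hi
    rw [e1, Finset.prod_insert h0] at h
    rw [h]
    simp only [Function.update_self, measure_univ, one_mul]
    exact Finset.prod_congr rfl fun i hi => by simp [hne i hi]

/-- The partial products `y_1 ⋯ y_k`. -/
def partialProd (k : ℕ) (y : ℕ → unitInterval) : ℝ := ∏ i ∈ Finset.range k, (y i : ℝ)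

theorem measurable_partialProd (k : ℕ) : Measurable (partialProd k) :=
  Finset.measurable_fun_prod _ fun i _ => measurable_subtype_coe.comp (measurable_pi_apply i)

@[simp] theorem partialProd_zero (y : ℕ → unitInterval) : partialProd 0 y = 1 := rfl

theorem partialProd_consSeq (k : ℕ) (p : unitInterval × (ℕ → unitInterval)) :
    partialProd (k + 1) (consSeq p) = p.1 * partialProd k p.2 := by
  rw [partialProd, Finset.prod_range_succ', mul_comm]
  rfl

theorem partialProd_succ_le (k : ℕ) (y : ℕ → unitInterval) :
    partialProd (k + 1) y ≤ partialProd k y := by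
  rw [partialProd, Finset.prod_range_succ]
  exact mul_le_of_le_one_right (Finset.prod_nonneg fun i _ => (y i).2.1) (y k).2.2

theorem partialProd_antitone (y : ℕ → unitInterval) : Antitone fun k => partialProd k y :=
  antitone_nat_of_succ_le fun k => partialProd_succ_le k y

theorem partialProd_le_one (k : ℕ) (y : ℕ → unitInterval) : partialProd k y ≤ 1 :=
  partialProd_antitone y (Nat.zero_le k)

/-- Conditioning on the first term of the sequence. -/
theorem uniformSeq_eq_lintegral {A : Set (ℕ → unitInterval)} (hA : MeasurableSet A)
    {Φ : ℝ → ENNReal}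
    (h : ∀ r : unitInterval, 0 < (r : ℝ) → uniformSeq {y | consSeq (r, y) ∈ A} = Φ r) :
    uniformSeq A = ∫⁻ r in Set.Ioc (0 : ℝ) 1, Φ r := by
  rw [← measurePreserving_consSeq.measure_preimage hA.nullMeasurableSet,
    Measure.prod_apply (measurable_consSeq hA)]
  -- The recursion divides the threshold by `r`, so the null event `r = 0` is discarded.
  have h0 : ∀ᵐ r : unitInterval, 0 < (r : ℝ) := by
    have : ∀ᵐ r : unitInterval, r ≠ 0 := by
      rw [ae_iff]; simp
    filter_upwards [this] with r hr
    exact lt_of_le_of_ne r.2.1 fun h => hr (Subtype.ext h.symm)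
  calc _ = ∫⁻ r : unitInterval, Φ r := by
        refine lintegral_congr_ae ?_
        filter_upwards [h0] with r hr
        exact h r hr
    _ = ∫⁻ r in Set.Icc (0 : ℝ) 1, Φ r :=
        lintegral_subtype_comap (s := Set.Icc (0 : ℝ) 1) measurableSet_Icc Φ
    _ = _ := setLIntegral_congr Ioc_ae_eq_Icc.symm

/-- After a first factor `r` the remaining time is `s + log r`, and this is the resulting integral
over `r`. The factor `1 / r` in `psi k (s + log r) = e^{-s} (s + log r)^k / (k! r)` makes the
integrand an exact derivative. The bound `e^{-s} ≤ c` keeps `s + log r`, and hence the integrand,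
nonnegative. -/
theorem lintegral_psi_log (k : ℕ) {s c d : ℝ} (hc : Real.exp (-s) ≤ c) (hcd : c ≤ d) {C : ℝ}
    (hC : 0 ≤ C) :
    ∫⁻ r in Set.Ioc c d, ENNReal.ofReal (C * psi k (s + Real.log r)) =
      ENNReal.ofReal (C * (Real.exp (-s) * ((s + Real.log d) ^ (k + 1) -
        (s + Real.log c) ^ (k + 1)) / ((k + 1).factorial : ℝ))) := by
  have hc0 : 0 < c := (Real.exp_pos _).trans_le hc
  have hder : ∀ r ∈ Set.uIcc c d, HasDerivAt
      (fun r => C * (Real.exp (-s) * (s + Real.log r) ^ (k + 1) / ((k + 1).factorial : ℝ)))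
      (C * psi k (s + Real.log r)) r := by
    intro r hr
    rw [Set.uIcc_of_le hcd] at hr
    have hr0 : 0 < r := hc0.trans_le hr.1
    have h1 := (((((Real.hasDerivAt_log hr0.ne').const_add s).pow (k + 1)).const_mul
      (Real.exp (-s))).div_const ((k + 1).factorial : ℝ)).const_mul C
    refine h1.congr_deriv ?_
    rw [psi, neg_add, Real.exp_add, Real.exp_neg (Real.log r), Real.exp_log hr0,
      Nat.factorial_succ]
    have : (k.factorial : ℝ) ≠ 0 := by positivity
    have : (k : ℝ) + 1 ≠ 0 := by positivity
    push_cast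
    field_simp
  have hpos : ∀ r ∈ Set.Ioc c d, 0 ≤ C * psi k (s + Real.log r) := by
    intro r hr
    refine mul_nonneg hC (psi_nonneg k ?_)
    have := (Real.le_log_iff_exp_le (hc0.trans hr.1)).2 (hc.trans hr.1.le)
    linarith
  have hcont : ContinuousOn (fun r => C * psi k (s + Real.log r)) (Set.uIcc c d) := by
    rw [Set.uIcc_of_le hcd]
    refine continuousOn_const.mul ((continuous_psi k).comp_continuousOn (continuousOn_const.add
      (Real.continuousOn_log.mono fun r hr => ?_)))
    exact (hc0.trans_le hr.1).ne'
  have hint := hcont.intervalIntegrable (μ := volume)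
  rw [← ofReal_integral_eq_lintegral_ofReal]
  · rw [← intervalIntegral.integral_of_le hcd,
      intervalIntegral.integral_eq_sub_of_hasDerivAt hder hint]
    congr 1
    ring
  · rwa [intervalIntegrable_iff_integrableOn_Ioc_of_le hcd] at hint
  · exact (ae_restrict_iff' measurableSet_Ioc).2 (Eventually.of_forall hpos)

/-- The event that the threshold `a` lies between two consecutive partial products. -/
def crossing (k : ℕ) (a : ℝ) : Set (ℕ → unitInterval) :=
  {y | partialProd (k + 1) y ≤ a ∧ a < partialProd k y}

theorem measurableSet_crossing (k : ℕ) (a : ℝ) : MeasurableSet (crossing k a) :=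
  (measurableSet_le (measurable_partialProd _) measurable_const).inter
    (measurableSet_lt measurable_const (measurable_partialProd _))

theorem exp_neg_div {s r : ℝ} (hr : 0 < r) :
    Real.exp (-s) / r = Real.exp (-(s + Real.log r)) := by
  rw [neg_add, Real.exp_add, Real.exp_neg (Real.log r), Real.exp_log hr]; rfl

theorem consSeq_mem_crossing_succ {k : ℕ} {a : ℝ} {r : unitInterval} (hr : 0 < (r : ℝ))
    (y : ℕ → unitInterval) : consSeq (r, y) ∈ crossing (k + 1) a ↔ y ∈ crossing k (a / r) := by
  simp only [crossing, Set.mem_ofPred_eq, partialProd_consSeq]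
  rw [le_div_iff₀' hr, div_lt_iff₀' hr]

theorem crossing_eq_empty {k : ℕ} {a : ℝ} (ha : 1 ≤ a) : crossing k a = ∅ := by
  ext y
  simp only [crossing, Set.mem_ofPred_eq, Set.mem_empty_iff_false, iff_false, not_and, not_lt]
  exact fun _ => (partialProd_le_one k y).trans ha

theorem uniformSeq_crossing_zero {t : ℝ} (ht : 0 < t) :
    uniformSeq (crossing 0 (Real.exp (-t))) = ENNReal.ofReal (psi 0 t) := by
  have h1 : Real.exp (-t) < 1 := by simpa using ht
  rw [uniformSeq_eq_lintegral (measurableSet_crossing _ _)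
    (Φ := (Set.Iic (Real.exp (-t))).indicator 1)]
  · rw [lintegral_indicator_one₀ measurableSet_Iic.nullMeasurableSet,
      Measure.restrict_apply measurableSet_Iic, Set.inter_comm, Set.Ioc_inter_Iic, min_eq_right h1.le]
    simp [psi]
  · intro r hr
    by_cases h : (r : ℝ) ≤ Real.exp (-t)
    · simp [crossing, partialProd_consSeq, h, ht]
    · simp [crossing, partialProd_consSeq, h]

/-- The Poisson law of the number of arrivals before `t`. Conditioning on the first factor `r`
removes one arrival and shortens the time to `t + log r`. If `r ≤ e^{-t}`, the first arrival is not
before `t` and the event is empty. -/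
theorem uniformSeq_crossing (k : ℕ) {t : ℝ} (ht : 0 < t) :
    uniformSeq (crossing k (Real.exp (-t))) = ENNReal.ofReal (psi k t) := by
  induction k generalizing t with
  | zero => exact uniformSeq_crossing_zero ht
  | succ k ih =>
    have h1 : Real.exp (-t) < 1 := by simpa using ht
    rw [uniformSeq_eq_lintegral (measurableSet_crossing _ _)
      (Φ := (Set.Ioi (Real.exp (-t))).indicator fun r => ENNReal.ofReal (1 * psi k (t + Real.log r)))]
    · rw [lintegral_indicator measurableSet_Ioi, Measure.restrict_restrict measurableSet_Ioi,
        Set.inter_comm, Set.Ioc_inter_Ioi, max_eq_right (Real.exp_pos _).le,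
        lintegral_psi_log k le_rfl h1.le zero_le_one]
      simp [psi]
      ring_nf
    · intro r hr
      simp only [consSeq_mem_crossing_succ hr, Set.ofPred_mem_eq]
      by_cases h : Real.exp (-t) < r
      · rw [Set.indicator_of_mem (by exact h), one_mul, exp_neg_div hr, ih]
        have := (Real.lt_log_iff_exp_lt hr).2 h
        linarith
      · rw [Set.indicator_of_notMem (by exact h), crossing_eq_empty, measure_empty]
        rw [le_div_iff₀ hr]; linarith

/-- No arrival before `s` and `j` before `t`. For `j ≥ 1` the first factor must lie in `(e^{-t},
e^{-s}]`, and the rest is a one-time probability. -/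
theorem uniformSeq_crossing_inter_zero (j : ℕ) {s t : ℝ} (hs : 0 < s) (hst : s ≤ t) :
    uniformSeq (crossing 0 (Real.exp (-s)) ∩ crossing j (Real.exp (-t))) =
      ENNReal.ofReal (psi 0 s * psi j (t - s)) := by
  have h1 : Real.exp (-s) < 1 := by simpa using hs
  have hts : Real.exp (-t) ≤ Real.exp (-s) := by simpa using hst
  cases j with
  | zero =>
    have : crossing 0 (Real.exp (-s)) ∩ crossing 0 (Real.exp (-t)) = crossing 0 (Real.exp (-t)) := by
      refine Set.inter_eq_right.2 fun y hy => ⟨hy.1.trans hts, ?_⟩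
      simpa using hs
    rw [this, uniformSeq_crossing_zero (hs.trans_le hst)]
    simp only [psi, pow_zero, Nat.factorial_zero, Nat.cast_one, div_one, one_mul, ← Real.exp_add]
    ring_nf
  | succ j =>
    rw [uniformSeq_eq_lintegral ((measurableSet_crossing _ _).inter (measurableSet_crossing _ _))
      (Φ := (Set.Ioc (Real.exp (-t)) (Real.exp (-s))).indicator
        fun r => ENNReal.ofReal (1 * psi j (t + Real.log r)))]
    · rw [lintegral_indicator measurableSet_Ioc, Measure.restrict_restrict measurableSet_Ioc,
        Set.inter_comm, Set.Ioc_inter_Ioc, max_eq_right (Real.exp_pos _).le, min_eq_right h1.le,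
        lintegral_psi_log j le_rfl hts zero_le_one]
      congr 1
      simp only [psi, pow_zero, Nat.factorial_zero, Real.log_exp]
      rw [show t + -t = 0 by ring, show -t = -s + -(t - s) by ring, Real.exp_add]
      simp
      ring
    · intro r hr
      simp only [Set.mem_inter_iff, consSeq_mem_crossing_succ hr]
      have e0 : ∀ y, consSeq (r, y) ∈ crossing 0 (Real.exp (-s)) ↔ (r : ℝ) ≤ Real.exp (-s) := by
        intro y
        simp [crossing, partialProd_consSeq, hs]
      simp only [e0]
      by_cases h : Real.exp (-t) < r
      · by_cases h' : (r : ℝ) ≤ Real.exp (-s)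
        · rw [Set.indicator_of_mem (by exact ⟨h, h'⟩), one_mul, exp_neg_div hr]
          simp only [h', true_and, Set.ofPred_mem_eq]
          rw [uniformSeq_crossing]
          have := (Real.lt_log_iff_exp_lt hr).2 h
          linarith
        · rw [Set.indicator_of_notMem (by exact fun hh => h' hh.2)]
          simp [h']
      · rw [Set.indicator_of_notMem (by exact fun hh => h hh.1), crossing_eq_empty]
        · simp
        · rw [le_div_iff₀ hr]; linarith

/-- Independent increments of the Poisson process. Removing the first arrival shifts `s` and `t` by
the same `log r`, so `t - s`, and with it the second factor, is unchanged throughout the induction.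
-/
theorem uniformSeq_crossing_inter (i j : ℕ) {s t : ℝ} (hs : 0 < s) (hst : s ≤ t) :
    uniformSeq (crossing i (Real.exp (-s)) ∩ crossing (i + j) (Real.exp (-t))) =
      ENNReal.ofReal (psi i s * psi j (t - s)) := by
  induction i generalizing s t with
  | zero => simpa using uniformSeq_crossing_inter_zero j hs hst
  | succ i ih =>
    have h1 : Real.exp (-s) < 1 := by simpa using hs
    rw [uniformSeq_eq_lintegral ((measurableSet_crossing _ _).inter (measurableSet_crossing _ _))
      (Φ := (Set.Ioi (Real.exp (-s))).indicator
        fun r => ENNReal.ofReal (psi j (t - s) * psi i (s + Real.log r)))]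
    · rw [lintegral_indicator measurableSet_Ioi, Measure.restrict_restrict measurableSet_Ioi,
        Set.inter_comm, Set.Ioc_inter_Ioi, max_eq_right (Real.exp_pos _).le,
        lintegral_psi_log i le_rfl h1.le (psi_nonneg j (by linarith))]
      congr 1
      rw [Real.log_exp, psi, psi]
      simp
      ring
    · intro r hr
      simp only [Set.mem_inter_iff, show i + 1 + j = i + j + 1 by ring,
        consSeq_mem_crossing_succ hr]
      by_cases h : Real.exp (-s) < r
      · rw [Set.indicator_of_mem (by exact h), exp_neg_div hr, exp_neg_div hr]
        have hl := (Real.lt_log_iff_exp_lt hr).2 h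
        have := ih (s := s + Real.log r) (t := t + Real.log r) (by linarith) (by linarith)
        rw [show t + Real.log r - (s + Real.log r) = t - s by ring, mul_comm] at this
        exact this
      · rw [Set.indicator_of_notMem (by exact h), crossing_eq_empty (k := i)]
        · simp
        · rw [le_div_iff₀ hr]; linarith

/-- The event that the `l`-th partial product is at most `a`. -/
def below (l : ℕ) (a : ℝ) : Set (ℕ → unitInterval) := {y | partialProd l y ≤ a}

theorem below_succ (l : ℕ) (a : ℝ) : below (l + 1) a = below l a ∪ crossing l a := by
  ext y
  have := partialProd_succ_le l y
  simp only [below, crossing, Set.mem_union, Set.mem_ofPred_eq]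
  constructor
  · intro h
    rcases le_or_gt (partialProd l y) a with h' | h'
    exacts [Or.inl h', Or.inr ⟨h, h'⟩]
  · rintro (h | h)
    exacts [this.trans h, h.1]

theorem disjoint_below_crossing (l : ℕ) (a : ℝ) : Disjoint (below l a) (crossing l a) :=
  Set.disjoint_left.2 fun _ h h' => absurd h (not_le.2 h'.2)

theorem below_zero {a : ℝ} (ha : a < 1) : below 0 a = ∅ := by
  ext y; simp [below, ha]

theorem uniformSeq_below (l : ℕ) {t : ℝ} (ht : 0 < t) :
    uniformSeq.real (below l (Real.exp (-t))) = ∑ k ∈ Finset.range l, psi k t := by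
  induction l with
  | zero => rw [below_zero (by simpa using ht)]; simp
  | succ l ih =>
    rw [below_succ, measureReal_union (disjoint_below_crossing _ _) (measurableSet_crossing _ _),
      ih, Finset.sum_range_succ, Measure.real, uniformSeq_crossing l ht,
      ENNReal.toReal_ofReal (psi_nonneg l ht.le)]

theorem uniformSeq_below_inter_crossing {l m : ℕ} (hlm : l ≤ m) {s t : ℝ} (hs : 0 < s)
    (hst : s ≤ t) :
    uniformSeq.real (below l (Real.exp (-s)) ∩ crossing m (Real.exp (-t))) =
      ∑ k ∈ Finset.range l, psi k s * psi (m - k) (t - s) := by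
  induction l with
  | zero => rw [below_zero (by simpa using hs)]; simp
  | succ l ih =>
    rw [below_succ, Set.union_inter_distrib_right, measureReal_union
      ((disjoint_below_crossing _ _).mono Set.inter_subset_left Set.inter_subset_left)
      ((measurableSet_crossing _ _).inter (measurableSet_crossing _ _)),
      ih (by omega), Finset.sum_range_succ, Measure.real]
    have := uniformSeq_crossing_inter l (m - l) hs hst
    rw [show l + (m - l) = m by omega] at this
    rw [this, ENNReal.toReal_ofReal
      (mul_nonneg (psi_nonneg l hs.le) (psi_nonneg _ (by linarith)))]

/-- The count of arrivals is nondecreasing in time: `m ≥ l` arrivals by the earlier time, with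
threshold `b`, exclude fewer than `l` by the later one, with threshold `a`. -/
theorem below_inter_crossing_eq_empty {l m : ℕ} (hlm : l ≤ m) {a b : ℝ} (hab : a ≤ b) :
    below l a ∩ crossing m b = ∅ := by
  ext y
  simp only [below, crossing, Set.mem_inter_iff, Set.mem_ofPred_eq, Set.mem_empty_iff_false,
    iff_false, not_and, not_lt]
  intro h _
  exact (partialProd_antitone y hlm).trans (h.trans hab)

theorem below_inter_below (l : ℕ) (a b : ℝ) : below l a ∩ below l b = below l (min a b) := by
  ext y; simp [below]

end

/-! ### Centered indicators and the covariances of their fibres. -/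

noncomputable section

section CenteredIndicator

variable {Y : Type*} [MeasurableSpace Y] {ν : Measure Y} [IsProbabilityMeasure ν]

/-- The indicator function of `A` minus a function of the first coordinate. -/
def centeredIndicator (A : Set (ℝ × Y)) (p : ℝ → ℝ) (z : ℝ × Y) : ℝ :=
  A.indicator (fun _ => 1) z - p z.1

theorem measurable_centeredIndicator {A : Set (ℝ × Y)} (hA : MeasurableSet A) {p : ℝ → ℝ}
    (hp : Measurable p) : Measurable (centeredIndicator A p) :=
  (measurable_const.indicator hA).sub (hp.comp measurable_fst)

theorem integral_section_centeredIndicator_mul {A B : Set (ℝ × Y)} (hA : MeasurableSet A)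
    (hB : MeasurableSet B) {p q : ℝ → ℝ} {x : ℝ} (hp : ν.real {y | (x, y) ∈ A} = p x)
    (hq : ν.real {y | (x, y) ∈ B} = q x) :
    Integrable (fun y => centeredIndicator A p (x, y) * centeredIndicator B q (x, y)) ν ∧
    ∫ y, centeredIndicator A p (x, y) * centeredIndicator B q (x, y) ∂ν =
      ν.real ({y | (x, y) ∈ A} ∩ {y | (x, y) ∈ B}) - p x * q x := by
  have mA : MeasurableSet {y | (x, y) ∈ A} := measurable_prodMk_left hA
  have mB : MeasurableSet {y | (x, y) ∈ B} := measurable_prodMk_left hB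
  have e : ∀ y, centeredIndicator A p (x, y) * centeredIndicator B q (x, y) =
      ((({y | (x, y) ∈ A} ∩ {y | (x, y) ∈ B}).indicator (fun _ => (1 : ℝ)) y
        - q x * {y | (x, y) ∈ A}.indicator (fun _ => (1 : ℝ)) y)
        - p x * {y | (x, y) ∈ B}.indicator (fun _ => (1 : ℝ)) y) + p x * q x := by
    intro y
    by_cases ha : (x, y) ∈ A <;> by_cases hb : (x, y) ∈ B <;>
      simp [centeredIndicator, ha, hb] <;> ring
  have i : ∀ s : Set Y, MeasurableSet s → Integrable (s.indicator fun _ => (1 : ℝ)) ν :=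
    fun s hs => (integrable_const _).indicator hs
  have i1 := i _ (mA.inter mB)
  have i2 := (i _ mA).const_mul (q x)
  have i3 := (i _ mB).const_mul (p x)
  have i4 : Integrable (fun _ : Y => p x * q x) ν := integrable_const _
  simp only [e]
  refine ⟨((i1.sub i2).sub i3).add i4, ?_⟩
  rw [integral_add (by exact (i1.sub i2).sub i3) i4, integral_sub (by exact i1.sub i2) i3,
    integral_sub i1 i2, integral_const_mul, integral_const_mul,
    integral_indicator_const _ (mA.inter mB), integral_indicator_const _ mA,
    integral_indicator_const _ mB, hp, hq]
  simp
  ring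

/-- The fibre over `x` contributes the Bernoulli variance `p x - p x * p x`. Centering is essential
for `tailKernel`: there `p x` tends to `1` as `x → ∞`, so the plain indicator is not square
integrable. -/
theorem memLp_centeredIndicator {A : Set (ℝ × Y)} (hA : MeasurableSet A) {p : ℝ → ℝ}
    (hpm : Measurable p) (hp : ∀ x, ν.real {y | (x, y) ∈ A} = p x)
    (hint : Integrable fun x => p x - p x * p x) :
    MemLp (centeredIndicator A p) 2 ((volume : Measure ℝ).prod ν) := by
  have hm := measurable_centeredIndicator hA hpm
  rw [memLp_two_iff_integrable_sq hm.aestronglyMeasurable,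
    integrable_prod_iff (hm.pow_const 2).aestronglyMeasurable]
  have h := fun x => integral_section_centeredIndicator_mul hA hA (hp x) (hp x)
  simp only [Set.inter_self, hp] at h
  refine ⟨Eventually.of_forall fun x => by simpa only [sq] using (h x).1, ?_⟩
  simpa only [Real.norm_eq_abs, abs_sq, sq, abs_mul_self, (h _).2] using hint

theorem integral_centeredIndicator_mul {A B : Set (ℝ × Y)} (hA : MeasurableSet A)
    (hB : MeasurableSet B) {p q : ℝ → ℝ} (hp : ∀ x, ν.real {y | (x, y) ∈ A} = p x)
    (hq : ∀ x, ν.real {y | (x, y) ∈ B} = q x)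
    (h1 : MemLp (centeredIndicator A p) 2 ((volume : Measure ℝ).prod ν))
    (h2 : MemLp (centeredIndicator B q) 2 ((volume : Measure ℝ).prod ν)) :
    ∫ z, centeredIndicator A p z * centeredIndicator B q z ∂((volume : Measure ℝ).prod ν) =
      ∫ x, (ν.real ({y | (x, y) ∈ A} ∩ {y | (x, y) ∈ B}) - p x * q x) := by
  have hint : Integrable (fun z => centeredIndicator A p z * centeredIndicator B q z)
      ((volume : Measure ℝ).prod ν) := h1.integrable_mul h2
  rw [integral_prod _ hint]
  exact integral_congr_ae (Eventually.of_forall fun x =>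
    (integral_section_centeredIndicator_mul hA hB (hp x) (hq x)).2)

end CenteredIndicator

/-! ### The lifted integrands -/

/-- `exp(-e^{-(x-u)})`. -/
def threshold (u x : ℝ) : ℝ := Real.exp (-Real.exp (-(x - u)))

theorem continuous_threshold (u : ℝ) : Continuous (threshold u) := by
  unfold threshold; fun_prop

theorem threshold_le_threshold {u v : ℝ} (h : u ≤ v) (x : ℝ) : threshold v x ≤ threshold u x := by
  unfold threshold; gcongr

theorem threshold_strictMono (u : ℝ) : StrictMono (threshold u) := by
  intro x y h
  unfold threshold
  gcongr

def belowEvent (l : ℕ) (u : ℝ) : Set (ℝ × (ℕ → unitInterval)) :=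
  {z | z.2 ∈ below l (threshold u z.1)}

def crossingEvent (l : ℕ) (u : ℝ) : Set (ℝ × (ℕ → unitInterval)) :=
  {z | z.2 ∈ crossing l (threshold u z.1)}

theorem measurableSet_belowEvent (l : ℕ) (u : ℝ) : MeasurableSet (belowEvent l u) :=
  measurableSet_le ((measurable_partialProd l).comp measurable_snd)
    ((continuous_threshold u).measurable.comp measurable_fst)

theorem measurableSet_crossingEvent (l : ℕ) (u : ℝ) : MeasurableSet (crossingEvent l u) :=
  (measurableSet_le ((measurable_partialProd (l + 1)).comp measurable_snd)
    ((continuous_threshold u).measurable.comp measurable_fst)).inter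
  (measurableSet_lt ((continuous_threshold u).measurable.comp measurable_fst)
    ((measurable_partialProd l).comp measurable_snd))

theorem uniformSeq_below_threshold (l : ℕ) (u x : ℝ) :
    uniformSeq.real (below l (threshold u x)) = poissonTail l u x :=
  uniformSeq_below l (Real.exp_pos _)

theorem uniformSeq_crossing_threshold (l : ℕ) (u x : ℝ) :
    uniformSeq.real (crossing l (threshold u x)) = poissonTerm l u x := by
  rw [Measure.real, threshold, uniformSeq_crossing l (Real.exp_pos _),
    ENNReal.toReal_ofReal (psi_nonneg l (Real.exp_pos _).le)]
  rfl

/-- The integrand of `-Z_l(u)`. -/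
def tailKernel (l : ℕ) (u : ℝ) : ℝ × (ℕ → unitInterval) → ℝ :=
  centeredIndicator (belowEvent l u) (poissonTail l u)

/-- The integrand of `X_l(u)`, as a function on `ℝ × [0,1]^ℕ`. -/
def stepKernel (l : ℕ) (u : ℝ) : ℝ × (ℕ → unitInterval) → ℝ :=
  centeredIndicator (crossingEvent l u) (poissonTerm l u)

theorem intensity_eq : intensity = (volume : Measure ℝ).prod uniformSeq := rfl

theorem memLp_tailKernel {l : ℕ} (hl : 1 ≤ l) (u : ℝ) : MemLp (tailKernel l u) 2 intensity := by
  refine memLp_centeredIndicator (measurableSet_belowEvent l u)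
    (continuous_poissonTail l u).measurable (uniformSeq_below_threshold l u) ?_
  simpa only [min_self] using (integral_min_poissonTail hl u u).1

theorem memLp_stepKernel {l : ℕ} (hl : 1 ≤ l) (u : ℝ) : MemLp (stepKernel l u) 2 intensity :=
  memLp_centeredIndicator (measurableSet_crossingEvent l u)
    (continuous_poissonTerm l u).measurable (uniformSeq_crossing_threshold l u)
    ((integral_poissonTerm hl u).1.sub (integral_poissonTerm_mul (by omega) u u).1)

/-- The identity behind `Z_{l+1} = Z_l - X_l`: both the events and their probabilities add up. -/
theorem tailKernel_succ (l : ℕ) (u : ℝ) (z : ℝ × (ℕ → unitInterval)) :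
    tailKernel (l + 1) u z = tailKernel l u z + stepKernel l u z := by
  have e : belowEvent (l + 1) u = belowEvent l u ∪ crossingEvent l u := by
    ext z
    simp only [belowEvent, crossingEvent, below_succ]
    rfl
  have hd : Disjoint (belowEvent l u) (crossingEvent l u) :=
    Set.disjoint_left.2 fun z hz hz' => Set.disjoint_left.1 (disjoint_below_crossing l _) hz hz'
  simp only [tailKernel, stepKernel, centeredIndicator, e, poissonTail_succ,
    Set.indicator_union_of_disjoint hd]
  ring

theorem tailKernel_add (l n : ℕ) (u : ℝ) (z : ℝ × (ℕ → unitInterval)) :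
    tailKernel (l + n) u z = tailKernel l u z + ∑ r ∈ Finset.range n, stepKernel (l + r) u z := by
  induction n with
  | zero => simp
  | succ n ih => rw [← add_assoc, tailKernel_succ, ih, Finset.sum_range_succ, add_assoc]

theorem integral_tailKernel_mul {l : ℕ} (hl : 1 ≤ l) (u v : ℝ) :
    ∫ z, tailKernel l u z * tailKernel l v z ∂intensity = covZ l u v := by
  rw [intensity_eq, ← (integral_min_poissonTail hl u v).2]
  refine (integral_centeredIndicator_mul (measurableSet_belowEvent l u)
    (measurableSet_belowEvent l v) (uniformSeq_below_threshold l u)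
    (uniformSeq_below_threshold l v) (memLp_tailKernel hl u) (memLp_tailKernel hl v)).trans ?_
  refine integral_congr_ae (Eventually.of_forall fun x => ?_)
  have : uniformSeq.real (below l (threshold u x) ∩ below l (threshold v x)) =
      min (poissonTail l u x) (poissonTail l v x) := by
    rw [below_inter_below]
    rcases le_total u v with h | h
    · rw [min_eq_right (threshold_le_threshold h x), min_eq_right (poissonTail_antitone l x h),
        uniformSeq_below_threshold]
    · rw [min_eq_left (threshold_le_threshold h x), min_eq_left (poissonTail_antitone l x h),
        uniformSeq_below_threshold]
  exact congrArg (· - _) this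

/-- Given `m` arrivals by time `t`, the number by time `w * t` is binomial with parameters `m` and
`w`. -/
theorem psi_mul_psi_sub {i m : ℕ} (him : i ≤ m) (w t : ℝ) :
    psi i (w * t) * psi (m - i) (t - w * t) = (m.choose i : ℝ) * (1 - w) ^ (m - i) * w ^ i *
      psi m t := by
  have e : Real.exp (-t) = Real.exp (-(w * t)) * Real.exp (-(t - w * t)) := by
    rw [← Real.exp_add]; ring_nf
  rw [psi, psi, psi, e, show t - w * t = (1 - w) * t by ring, mul_pow, mul_pow,
    Nat.cast_choose ℝ him]
  have h : t ^ m = t ^ i * t ^ (m - i) := by rw [← pow_add]; congr 1; omega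
  rw [h]
  have : (m.factorial : ℝ) ≠ 0 := by positivity
  field_simp

/-- The ratio of the two times is `e^{u-v}`. If `u ≤ v` it is at most `1` and the binomial law
applies. Otherwise the events are disjoint, which the positive part encodes. -/
theorem uniformSeq_below_inter_crossing_threshold {l m : ℕ} (hlm : l ≤ m) (u v x : ℝ) :
    uniformSeq.real (below l (threshold u x) ∩ crossing m (threshold v x)) =
      (∑ i ∈ Finset.range l, (m.choose i : ℝ) * (max (1 - Real.exp (u - v)) 0) ^ (m - i) *
        Real.exp ((u - v) * i)) * poissonTerm m v x := by
  rcases le_total u v with h | h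
  · have hs : Real.exp (-(x - u)) = Real.exp (u - v) * Real.exp (-(x - v)) := by
      rw [← Real.exp_add]; ring_nf
    have hw : Real.exp (u - v) ≤ 1 := by simpa using h
    rw [threshold, threshold, uniformSeq_below_inter_crossing hlm (Real.exp_pos _)
      (by gcongr), Finset.sum_mul]
    refine Finset.sum_congr rfl fun i hi => ?_
    have hi := Finset.mem_range.1 hi
    rw [hs, psi_mul_psi_sub (by omega), max_eq_left (by linarith), poissonTerm, mul_comm (u - v),
      Real.exp_nat_mul]
  · rw [below_inter_crossing_eq_empty hlm (threshold_le_threshold h x), measureReal_empty,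
      Finset.sum_eq_zero, zero_mul]
    intro i hi
    have hi := Finset.mem_range.1 hi
    have hw : 1 ≤ Real.exp (u - v) := by simpa using h
    -- Here `i < l ≤ m`, so the exponent `m - i` is positive and the power of `0` vanishes.
    rw [max_eq_right (by linarith), zero_pow (by omega)]
    simp

theorem integral_tailKernel_mul_stepKernel {l m : ℕ} (hl : 1 ≤ l) (hlm : l ≤ m) (u v : ℝ) :
    ∫ z, tailKernel l u z * stepKernel m v z ∂intensity =
      ∑ i ∈ Finset.range l, (1 / (m : ℝ) * (m.choose i : ℝ) *
        (max (1 - Real.exp (u - v)) 0) ^ (m - i) * Real.exp ((u - v) * i)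
      - 1 / ((m : ℝ) + i) * ((m + i).choose i : ℝ) *
        (Real.exp ((u - v) * i) / (1 + Real.exp (u - v)) ^ (m + i))) := by
  rw [intensity_eq, ← (integral_crossTerm (hl.trans hlm) u v).2]
  refine (integral_centeredIndicator_mul (measurableSet_belowEvent l u)
    (measurableSet_crossingEvent m v) (uniformSeq_below_threshold l u)
    (uniformSeq_crossing_threshold m v) (memLp_tailKernel hl u)
    (memLp_stepKernel (hl.trans hlm) v)).trans ?_
  refine integral_congr_ae (Eventually.of_forall fun x => ?_)
  exact congrArg (· - _) (uniformSeq_below_inter_crossing_threshold hlm u v x)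

theorem integral_tailKernel_mul_add {l : ℕ} (hl : 1 ≤ l) (n : ℕ) (u v : ℝ) :
    ∫ z, tailKernel l u z * tailKernel (l + n) v z ∂intensity = crossCovZ l n u v := by
  simp only [tailKernel_add l n, mul_add, Finset.mul_sum]
  have i1 := (memLp_tailKernel hl u).integrable_mul (memLp_tailKernel hl v)
  have i2 : ∀ r, Integrable (fun z => tailKernel l u z * stepKernel (l + r) v z) intensity :=
    fun r => (memLp_tailKernel hl u).integrable_mul (memLp_stepKernel (by omega) v)
  rw [integral_add (by exact i1) (integrable_finsetSum _ fun r _ => i2 r),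
    integral_finsetSum _ fun r _ => i2 r, integral_tailKernel_mul hl, crossCovZ]
  congr 1
  refine Finset.sum_congr rfl fun r _ => ?_
  rw [integral_tailKernel_mul_stepKernel hl (by omega)]
  push_cast
  rfl

/-- For `u ≤ v` the left side is the integral of `d - d²`, where `d` is the difference of the two
tails. Dropping the square leaves `∫ d = v - u`. -/
theorem covZ_increment_le {l : ℕ} (hl : 1 ≤ l) (u v : ℝ) :
    covZ l u u + covZ l v v - 2 * covZ l u v ≤ |u - v| := by
  wlog h : u ≤ v generalizing u v
  · have := this v u (le_of_not_ge h)
    have e : covZ l v u = covZ l u v := by simp only [covZ, abs_sub_comm v u]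
    rw [e, abs_sub_comm] at this
    linarith
  obtain ⟨i1, e1⟩ := integral_min_poissonTail hl u u
  obtain ⟨i2, e2⟩ := integral_min_poissonTail hl v v
  obtain ⟨i3, e3⟩ := integral_min_poissonTail hl u v
  obtain ⟨i4, e4⟩ := integral_poissonTail_sub hl h
  rw [abs_sub_comm, abs_of_nonneg (sub_nonneg.2 h), ← e4, ← e1, ← e2, ← e3, ← integral_add i1 i2,
    ← integral_const_mul, ← integral_sub (by exact i1.add i2) (i3.const_mul 2)]
  refine integral_mono ((i1.add i2).sub (i3.const_mul 2)) i4 fun x => ?_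
  simp only [min_self, min_eq_right (poissonTail_antitone l x h)]
  nlinarith [sq_nonneg (poissonTail l u x - poissonTail l v x)]

/-! ### The processes as integrals with respect to the full noise -/

/-- The projection of `ℝ × [0,1]^ℕ` onto `ℝ × [0,1]^l`. -/
def truncateSeq (l : ℕ) (p : ℝ × (ℕ → unitInterval)) : ℝ × (Fin l → unitInterval) :=
  (p.1, fun i => p.2 i)

theorem measurePreserving_truncateSeq (l : ℕ) :
    MeasurePreserving (truncateSeq l) intensity volume := by
  have h : MeasurePreserving (fun (y : ℕ → unitInterval) (i : Fin l) => y i) uniformSeq volume := by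
    refine ⟨by fun_prop, ?_⟩
    rw [uniformSeq, Measure.map_infinitePi_infinitePi_of_inj Fin.val_injective,
      Measure.infinitePi_eq_pi]
    rfl
  exact (MeasurePreserving.id volume).prod h

theorem psi_zero_exp (u x : ℝ) : psi 0 (Real.exp (-(x - u))) = threshold u x := by
  simp [psi, threshold]

theorem kernelZ_truncateSeq (u : ℝ) (z : ℝ × (ℕ → unitInterval)) :
    kernelZ u (truncateSeq 1 z) = tailKernel 1 u z := by
  rw [kernelZ, tailKernel, centeredIndicator, poissonTail_one]
  congr 1
  simp only [Set.indicator, belowEvent, below, truncateSeq, threshold, partialProd]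
  simp

/-- For fixed `y` at most one `x` gives equality, because `threshold u` is strictly increasing. This
reconciles the strict inequality in `kernelX` with the weak one in `crossing`. -/
theorem ae_threshold_ne (u : ℝ) (k : ℕ) :
    ∀ᵐ z ∂intensity, partialProd k z.2 ≠ threshold u z.1 := by
  have hm : MeasurableSet {z : ℝ × (ℕ → unitInterval) | partialProd k z.2 = threshold u z.1} :=
    measurableSet_eq_fun ((measurable_partialProd k).comp measurable_snd)
      ((continuous_threshold u).measurable.comp measurable_fst)
  rw [ae_iff]
  simp only [not_not]
  rw [intensity_eq, Measure.prod_apply_symm hm, lintegral_eq_zero_iff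
    (measurable_measure_prodMk_right hm)]
  refine Eventually.of_forall fun y => ?_
  refine Set.Subsingleton.measure_zero (fun a ha b hb => ?_) _
  exact (threshold_strictMono u).injective (ha.symm.trans hb)

theorem kernelX_truncateSeq (l : ℕ) (u : ℝ) :
    (fun z => kernelX l u (truncateSeq (l + 1) z)) =ᵐ[intensity] stepKernel l u := by
  filter_upwards [ae_threshold_ne u (l + 1)] with z hz
  have e1 : ∏ i : Fin (l + 1), ((truncateSeq (l + 1) z).2 i : ℝ) = partialProd (l + 1) z.2 :=
    (Finset.prod_range fun i => (z.2 i : ℝ)).symm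
  have e2 : ∏ i : Fin l, ((truncateSeq (l + 1) z).2 i.castSucc : ℝ) = partialProd l z.2 :=
    (Finset.prod_range fun i => (z.2 i : ℝ)).symm
  rw [kernelX, stepKernel, centeredIndicator]
  congr 1
  have iff : truncateSeq (l + 1) z ∈ {q : ℝ × (Fin (l + 1) → unitInterval) |
      ∏ i : Fin (l + 1), (q.2 i : ℝ) < psi 0 (Real.exp (-(q.1 - u))) ∧
      psi 0 (Real.exp (-(q.1 - u))) < ∏ i : Fin l, (q.2 i.castSucc : ℝ)} ↔
      z ∈ crossingEvent l u := by
    simp only [Set.mem_ofPred_eq, e1, e2, psi_zero_exp, crossingEvent, crossing]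
    exact and_congr_left fun _ => ⟨le_of_lt, fun h => lt_of_le_of_ne h hz⟩
  by_cases h : z ∈ crossingEvent l u
  · rw [Set.indicator_of_mem h, Set.indicator_of_mem (iff.2 h)]
  · rw [Set.indicator_of_notMem h, Set.indicator_of_notMem (fun h' => h (iff.1 h'))]

theorem measurable_kernelZ (u : ℝ) : Measurable (kernelZ u) := by
  unfold kernelZ
  refine (measurable_const.indicator (measurableSet_le ?_ ?_)).sub ?_ <;> fun_prop

theorem measurable_kernelX (l : ℕ) (u : ℝ) : Measurable (kernelX l u) := by
  have h : Measurable fun q : ℝ × (Fin (l + 1) → unitInterval) => Real.exp (-(q.1 - u)) := by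
    fun_prop
  have h1 : MeasurableSet {q : ℝ × (Fin (l + 1) → unitInterval) |
      ∏ i : Fin (l + 1), (q.2 i : ℝ) < psi 0 (Real.exp (-(q.1 - u)))} :=
    measurableSet_lt (by fun_prop) ((continuous_psi 0).measurable.comp h)
  have h2 : MeasurableSet {q : ℝ × (Fin (l + 1) → unitInterval) |
      psi 0 (Real.exp (-(q.1 - u))) < ∏ i : Fin l, (q.2 i.castSucc : ℝ)} :=
    measurableSet_lt ((continuous_psi 0).measurable.comp h) (by fun_prop)
  exact (measurable_const.indicator (h1.inter h2)).sub ((continuous_psi l).measurable.comp h)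

section Processes

variable {Ω : Type*} [MeasurableSpace Ω] {P : Measure Ω}
  {W : Set (ℝ × (ℕ → unitInterval)) → Ω → ℝ}

theorem IsWhiteNoise.whiteNoiseIntegral_restrict (hW : IsWhiteNoise W intensity P) {l : ℕ}
    {f : ℝ × (Fin l → unitInterval) → ℝ} (hm : Measurable f)
    {g : ℝ × (ℕ → unitInterval) → ℝ} (hg : MemLp g 2 intensity)
    (hfg : (fun z => f (truncateSeq l z)) =ᵐ[intensity] g) :
    IsWhiteNoiseIntegral W intensity P g
      (whiteNoiseIntegral (restrictNoise W l) volume P f) := by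
  have hπ := measurePreserving_truncateSeq l
  have hf : MemLp f 2 volume := by
    rw [← hπ.map_eq, memLp_map_measure_iff hm.aestronglyMeasurable hπ.measurable.aemeasurable]
    exact hg.ae_eq hfg.symm
  exact ((whiteNoiseIntegral_spec (hW.map hπ) hf).comp_measurePreserving hπ).congr hfg

theorem IsWhiteNoise.isIntegral_procX (hW : IsWhiteNoise W intensity P) {l : ℕ} (hl : 1 ≤ l) (u : ℝ) :
    IsWhiteNoiseIntegral W intensity P (stepKernel l u) (procX W P l u) :=
  hW.whiteNoiseIntegral_restrict (measurable_kernelX l u) (memLp_stepKernel hl u)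
    (kernelX_truncateSeq l u)

theorem IsWhiteNoise.isIntegral_procZ (hW : IsWhiteNoise W intensity P) {l : ℕ} (hl : 1 ≤ l) (u : ℝ) :
    IsWhiteNoiseIntegral W intensity P (fun z => -1 * tailKernel l u z) (procZ W P l u) := by
  have h1 := hW.whiteNoiseIntegral_restrict (measurable_kernelZ u) (memLp_tailKernel le_rfl u)
    (Eventually.of_forall (kernelZ_truncateSeq u))
  have h2 := IsWhiteNoiseIntegral.sum hW (Finset.range (l - 1)) fun r _ =>
    hW.isIntegral_procX (l := 1 + r) (by omega) u
  have h3 := (h1.add hW h2).const_mul (-1)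
  simp only [← tailKernel_add, show 1 + (l - 1) = l by omega] at h3
  convert h3 using 1
  funext ω
  rw [procZ, procZOne, Finset.sum_Ico_eq_sum_range]
  ring

end Processes

end

/-! ### Dyadic chaining and the Kolmogorov–Chentsov theorem. -/

noncomputable section

/-- The dyadic approximation `⌊2^n u⌋ / 2^n`. -/
def dyadicFloor (n : ℕ) (u : ℝ) : ℝ := (⌊(2 : ℝ) ^ n * u⌋ : ℝ) / 2 ^ n

theorem abs_sub_dyadicFloor_le (n : ℕ) (u : ℝ) : |dyadicFloor n u - u| ≤ (1 / 2) ^ n := by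
  have h2 : (0 : ℝ) < 2 ^ n := by positivity
  have h : dyadicFloor n u - u = ((⌊(2 : ℝ) ^ n * u⌋ : ℝ) - 2 ^ n * u) / 2 ^ n := by
    rw [dyadicFloor]; field_simp
  rw [h, abs_div, abs_of_pos h2, one_div_pow]
  gcongr
  rw [abs_le]
  constructor <;> linarith [Int.floor_le ((2 : ℝ) ^ n * u), Int.lt_floor_add_one ((2 : ℝ) ^ n * u)]

/-- The increments of `z` over the dyadic intervals of length `2⁻ⁿ` near `[-N, N]` are at most
`K g ^ n`. -/
def DyadicBound (z : ℝ → ℝ) (N : ℕ) (K g : ℝ) : Prop :=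
  ∀ (n : ℕ) (k : ℤ), k ∈ Finset.Icc (-((N * 2 ^ n : ℕ) : ℤ)) ((N * 2 ^ n : ℕ) : ℤ) →
    |z (((k : ℝ) + 1) / 2 ^ n) - z ((k : ℝ) / 2 ^ n)| ≤ K * g ^ n

theorem floor_mem_Icc {N : ℕ} {u : ℝ} (hu : u ∈ Set.Icc (-(N : ℝ)) N) (n : ℕ) :
    ⌊(2 : ℝ) ^ n * u⌋ ∈ Finset.Icc (-((N * 2 ^ n : ℕ) : ℤ)) ((N * 2 ^ n : ℕ) : ℤ) := by
  have h2 : (0 : ℝ) < 2 ^ n := by positivity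
  rw [Finset.mem_Icc]
  constructor
  · rw [Int.le_floor]
    push_cast
    nlinarith [hu.1]
  · rw [← Int.floor_natCast (R := ℝ) (N * 2 ^ n)]
    refine Int.floor_le_floor ?_
    push_cast
    nlinarith [hu.2]

section DyadicBound

variable {z : ℝ → ℝ} {N : ℕ} {K g : ℝ}

theorem DyadicBound.dist_succ_le (h : DyadicBound z N K g) (hK : 0 ≤ K) (hg : 0 ≤ g) (hg1 : g ≤ 1)
    {u : ℝ} (hu : u ∈ Set.Icc (-(N : ℝ)) N) (n : ℕ) :
    dist (z (dyadicFloor n u)) (z (dyadicFloor (n + 1) u)) ≤ K * g ^ n := by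
  set k := ⌊(2 : ℝ) ^ n * u⌋ with hk
  have h2 : (0 : ℝ) < 2 ^ n := by positivity
  have hk1 := Int.floor_le ((2 : ℝ) ^ n * u)
  have hk2 := Int.lt_floor_add_one ((2 : ℝ) ^ n * u)
  rw [← hk] at hk1 hk2
  have e0 : dyadicFloor n u = ((2 * k : ℤ) : ℝ) / 2 ^ (n + 1) := by
    rw [dyadicFloor, ← hk, pow_succ]; push_cast; field_simp
  have hpos : 0 ≤ K * g ^ n := by positivity
  -- Refining the grid either keeps the approximating point or moves it by one interval of level `n
  -- + 1`, so a single bounded increment is paid.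
  have hcase : ⌊(2 : ℝ) ^ (n + 1) * u⌋ = 2 * k ∨ ⌊(2 : ℝ) ^ (n + 1) * u⌋ = 2 * k + 1 := by
    rcases lt_or_ge ((2 : ℝ) ^ (n + 1) * u) (2 * k + 1) with h' | h'
    · left
      rw [Int.floor_eq_iff]
      push_cast
      rw [pow_succ] at *
      constructor <;> linarith
    · right
      rw [Int.floor_eq_iff]
      push_cast
      rw [pow_succ] at *
      constructor <;> linarith
  rcases hcase with hc | hc
  · rw [e0, dyadicFloor, hc, dist_self]
    exact hpos
  · have hmem := Finset.mem_Icc.1 (floor_mem_Icc hu n)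
    have := h (n + 1) (2 * k) (by
      rw [Finset.mem_Icc]
      push_cast at hmem ⊢
      rw [pow_succ]
      constructor <;> linarith [hmem.1, hmem.2])
    rw [dist_comm, Real.dist_eq, e0, dyadicFloor, hc]
    push_cast at this ⊢
    refine this.trans ?_
    have : g ^ (n + 1) ≤ g ^ n := pow_le_pow_of_le_one hg hg1 (by omega)
    gcongr

theorem DyadicBound.exists_tendsto (h : DyadicBound z N K g) (hK : 0 ≤ K) (hg : 0 ≤ g)
    (hg1 : g < 1) {u : ℝ} (hu : u ∈ Set.Icc (-(N : ℝ)) N) :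
    ∃ y, Tendsto (fun n => z (dyadicFloor n u)) atTop (𝓝 y) :=
  cauchySeq_tendsto_of_complete
    (cauchySeq_of_le_geometric g K hg1 fun n => h.dist_succ_le hK hg hg1.le hu n)

theorem DyadicBound.dist_limit_le (h : DyadicBound z N K g) (hK : 0 ≤ K) (hg : 0 ≤ g)
    (hg1 : g < 1) {u y : ℝ} (hu : u ∈ Set.Icc (-(N : ℝ)) N)
    (hy : Tendsto (fun n => z (dyadicFloor n u)) atTop (𝓝 y)) (n : ℕ) :
    dist (z (dyadicFloor n u)) y ≤ K * g ^ n / (1 - g) :=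
  dist_le_of_le_geometric_of_tendsto g K hg1 (fun n => h.dist_succ_le hK hg hg1.le hu n) hy n

/-- Points at distance at most `2⁻ⁿ` have equal or neighbouring dyadic floors at level `n`. The
constant collects one such increment and the two geometric tails from the floors to the limits. -/
theorem DyadicBound.dist_limit_limit_le (h : DyadicBound z N K g) (hK : 0 ≤ K) (hg : 0 ≤ g)
    (hg1 : g < 1) {u v y y' : ℝ} (hu : u ∈ Set.Icc (-(N : ℝ)) N) (hv : v ∈ Set.Icc (-(N : ℝ)) N)
    (hy : Tendsto (fun n => z (dyadicFloor n u)) atTop (𝓝 y))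
    (hy' : Tendsto (fun n => z (dyadicFloor n v)) atTop (𝓝 y')) (huv : u ≤ v) {n : ℕ}
    (hd : v - u ≤ (1 / 2) ^ n) :
    dist y y' ≤ K * (2 / (1 - g) + 1) * g ^ n := by
  have h2 : (0 : ℝ) < 2 ^ n := by positivity
  have hmid : dist (z (dyadicFloor n u)) (z (dyadicFloor n v)) ≤ K * g ^ n := by
    have hpos : 0 ≤ K * g ^ n := by positivity
    have hle : ⌊(2 : ℝ) ^ n * u⌋ ≤ ⌊(2 : ℝ) ^ n * v⌋ := Int.floor_le_floor (by gcongr)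
    have hle' : ⌊(2 : ℝ) ^ n * v⌋ ≤ ⌊(2 : ℝ) ^ n * u⌋ + 1 := by
      rw [← Int.floor_add_one]
      refine Int.floor_le_floor ?_
      have : (2 : ℝ) ^ n * (v - u) ≤ 2 ^ n * (1 / 2) ^ n := by gcongr
      rw [← mul_pow] at this
      norm_num at this
      linarith
    rcases (show ⌊(2 : ℝ) ^ n * v⌋ = ⌊(2 : ℝ) ^ n * u⌋ ∨
      ⌊(2 : ℝ) ^ n * v⌋ = ⌊(2 : ℝ) ^ n * u⌋ + 1 by omega) with hc | hc
    · rw [dyadicFloor, dyadicFloor, hc, dist_self]; exact hpos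
    · rw [dist_comm, Real.dist_eq, dyadicFloor, dyadicFloor, hc]
      simpa using h n _ (floor_mem_Icc hu n)
  have a := h.dist_limit_le hK hg hg1 hu hy n
  have b := h.dist_limit_le hK hg hg1 hv hy' n
  have t1 := dist_triangle y (z (dyadicFloor n u)) y'
  have t2 := dist_triangle (z (dyadicFloor n u)) (z (dyadicFloor n v)) y'
  rw [dist_comm] at a
  have e : K * (2 / (1 - g) + 1) * g ^ n = K * g ^ n / (1 - g) + K * g ^ n / (1 - g) + K * g ^ n := by
    ring
  linarith

/-- A function that is controlled on dyadic intervals has a Hölder continuous dyadic limit. -/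
theorem DyadicBound.exists_holder (α : ℝ) (hα : 0 < α)
    (h : DyadicBound z N K ((1 / 2) ^ α)) (hK : 0 ≤ K) {y : ℝ → ℝ}
    (hy : ∀ u ∈ Set.Icc (-(N : ℝ)) N, Tendsto (fun n => z (dyadicFloor n u)) atTop (𝓝 (y u))) :
    ∃ C, 0 ≤ C ∧ ∀ u ∈ Set.Icc (-(N : ℝ)) N, ∀ v ∈ Set.Icc (-(N : ℝ)) N,
      dist (y u) (y v) ≤ C * dist u v ^ α := by
  set g : ℝ := (1 / 2 : ℝ) ^ α with hgdef
  have hg : 0 < g := by positivity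
  have hg1 : g < 1 := Real.rpow_lt_one (by norm_num) (by norm_num) hα
  have hg1' : 0 < 1 - g := by linarith
  set B := K * (2 / (1 - g) + 1) with hB
  have hB0 : 0 ≤ B := by positivity
  -- The values at the integer points bound the limit function on `[-N, N]`, which settles distances
  -- larger than `1`.
  set D := ∑ k ∈ Finset.Icc (-((N * 2 ^ 0 : ℕ) : ℤ)) ((N * 2 ^ 0 : ℕ) : ℤ), |z ((k : ℝ) / 2 ^ 0)|
    with hD
  have hD0 : 0 ≤ D := Finset.sum_nonneg fun _ _ => abs_nonneg _
  have hbound : ∀ u ∈ Set.Icc (-(N : ℝ)) N, |y u| ≤ D + K / (1 - g) := by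
    intro u hu
    have h1 := h.dist_limit_le hK hg.le hg1 hu (hy u hu) 0
    have h2 : |z (dyadicFloor 0 u)| ≤ D :=
      Finset.single_le_sum (f := fun k : ℤ => |z ((k : ℝ) / 2 ^ 0)|) (fun _ _ => abs_nonneg _)
        (floor_mem_Icc hu 0)
    rw [dist_comm, Real.dist_eq, pow_zero, mul_one] at h1
    have h3 := abs_sub_abs_le_abs_sub (y u) (z (dyadicFloor 0 u))
    linarith
  have hg2 : 0 ≤ 2 * (D + K / (1 - g)) := by positivity
  have hg3 : 0 ≤ B / g := by positivity
  refine ⟨B / g + 2 * (D + K / (1 - g)), by positivity, ?_⟩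
  have key : ∀ u ∈ Set.Icc (-(N : ℝ)) N, ∀ v ∈ Set.Icc (-(N : ℝ)) N, u ≤ v →
      dist (y u) (y v) ≤ (B / g + 2 * (D + K / (1 - g))) * dist u v ^ α := by
    intro u hu v hv huv
    rcases huv.eq_or_lt with rfl | hlt
    · rw [dist_self]
      positivity
    have hdist : dist u v = v - u := by
      rw [dist_comm, Real.dist_eq, abs_of_nonneg (by linarith)]
    have hd0 : 0 < v - u := by linarith
    have hpow : 0 ≤ (v - u) ^ α := by positivity
    rw [hdist, add_mul]
    rcases le_or_gt (v - u) 1 with hle | hgt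
    -- The scale is chosen so that `2^{-(n+1)} < v - u ≤ 2^{-n}`. The lower bound turns `g ^ (n +
    -- 1)` into `(v - u) ^ α`, at the price of a factor `1 / g`.
    · obtain ⟨n, hn1, hn2⟩ := exists_nat_pow_near_of_lt_one hd0 hle
        (show (0 : ℝ) < 1 / 2 by norm_num) (by norm_num)
      have h1 := h.dist_limit_limit_le hK hg.le hg1 hu hv (hy u hu) (hy v hv) huv hn2
      have h2 : g ^ (n + 1) ≤ (v - u) ^ α := by
        rw [hgdef, ← Real.rpow_natCast, ← Real.rpow_mul (by norm_num), mul_comm,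
          Real.rpow_mul (by norm_num), Real.rpow_natCast]
        exact Real.rpow_le_rpow (by positivity) hn1.le hα.le
      have h3 : B * g ^ n = B / g * g ^ (n + 1) := by rw [pow_succ]; field_simp
      rw [← hB, h3] at h1
      have h4 : B / g * g ^ (n + 1) ≤ B / g * (v - u) ^ α := by gcongr
      have h5 : 0 ≤ 2 * (D + K / (1 - g)) * (v - u) ^ α := by positivity
      linarith
    · have h1 : (1 : ℝ) ≤ (v - u) ^ α := Real.one_le_rpow hgt.le hα.le
      have h2 : dist (y u) (y v) ≤ 2 * (D + K / (1 - g)) := by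
        rw [Real.dist_eq]
        have := abs_sub (y u) (y v)
        linarith [hbound u hu, hbound v hv]
      have h3 : 2 * (D + K / (1 - g)) * 1 ≤ 2 * (D + K / (1 - g)) * (v - u) ^ α := by gcongr
      have h4 : 0 ≤ B / g * (v - u) ^ α := by positivity
      linarith
  intro u hu v hv
  rcases le_total u v with huv | huv
  · exact key u hu v hv huv
  · rw [dist_comm (y u), dist_comm u]
    exact key v hv u hu huv

end DyadicBound

section Modification

variable {Ω : Type*} [MeasurableSpace Ω] {P : Measure Ω}

theorem ae_tsum_lt_top {f : ℕ → Ω → ENNReal} (hf : ∀ n, AEMeasurable (f n) P) {A : ℝ}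
    (h : ∀ n, ∫⁻ ω, f n ω ∂P ≤ ENNReal.ofReal (A * (1 / 2) ^ n)) :
    ∀ᵐ ω ∂P, ∑' n, f n ω < ⊤ := by
  refine ae_lt_top' (AEMeasurable.tsum hf) ?_
  rw [lintegral_tsum hf]
  refine ne_top_of_le_ne_top ?_ (ENNReal.tsum_le_tsum h)
  have hs : Summable fun n : ℕ => |A| * (1 / 2 : ℝ) ^ n := summable_geometric_two.mul_left _
  refine ne_top_of_le_ne_top hs.tsum_ofReal_ne_top (ENNReal.tsum_le_tsum fun n => ?_)
  refine ENNReal.ofReal_le_ofReal ?_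
  gcongr
  exact le_abs_self A

/-- The weight `2^{n(m-2)}` turns the moment bound `C 2^{-nm}` into `C 4^{-n}`. Summed over the `2 N
2^n + 1` intervals of level `n` this is at most `(2N + 1) C 2^{-n}`, so the sum over all levels is
almost surely finite and bounds each term. -/
theorem ae_exists_bound_increment {Z : ℝ → Ω → ℝ} (hZ : ∀ u, AEMeasurable (Z u) P) {m : ℕ}
    (hm : 2 ≤ m) {C : ℝ} (hC : 0 ≤ C)
    (h : ∀ u v, ∫⁻ ω, ENNReal.ofReal (|Z u ω - Z v ω| ^ (2 * m)) ∂P ≤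
      ENNReal.ofReal (C * |u - v| ^ m)) (N : ℕ) :
    ∀ᵐ ω ∂P, ∃ K, 0 ≤ K ∧ ∀ (n : ℕ) (k : ℤ),
      k ∈ Finset.Icc (-((N * 2 ^ n : ℕ) : ℤ)) ((N * 2 ^ n : ℕ) : ℤ) →
      |Z (((k : ℝ) + 1) / 2 ^ n) ω - Z ((k : ℝ) / 2 ^ n) ω| ^ (2 * m) * 2 ^ (n * (m - 2)) ≤ K := by
  set I : ℕ → Finset ℤ := fun n => Finset.Icc (-((N * 2 ^ n : ℕ) : ℤ)) ((N * 2 ^ n : ℕ) : ℤ) with hI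
  set F : ℕ → ℤ → Ω → ENNReal := fun n k ω => ENNReal.ofReal
    (|Z (((k : ℝ) + 1) / 2 ^ n) ω - Z ((k : ℝ) / 2 ^ n) ω| ^ (2 * m) * 2 ^ (n * (m - 2))) with hF
  have hFm : ∀ n k, AEMeasurable (F n k) P := by
    intro n k
    have h1 := hZ (((k : ℝ) + 1) / 2 ^ n)
    have h2 := hZ ((k : ℝ) / 2 ^ n)
    have h3 := (h1.sub h2).norm
    exact ((h3.pow_const (2 * m)).mul_const _).ennreal_ofReal
  have hFi : ∀ n k, ∫⁻ ω, F n k ω ∂P ≤ ENNReal.ofReal (C * (1 / 4) ^ n) := by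
    intro n k
    have h1 := h (((k : ℝ) + 1) / 2 ^ n) ((k : ℝ) / 2 ^ n)
    have e : ∀ ω, F n k ω = ENNReal.ofReal
        (|Z (((k : ℝ) + 1) / 2 ^ n) ω - Z ((k : ℝ) / 2 ^ n) ω| ^ (2 * m)) *
          ENNReal.ofReal (2 ^ (n * (m - 2))) := fun ω => ENNReal.ofReal_mul (by positivity)
    simp only [e]
    rw [lintegral_mul_const' _ _ ENNReal.ofReal_ne_top]
    refine (mul_le_mul_left h1 _).trans ?_
    rw [← ENNReal.ofReal_mul (by positivity)]
    refine ENNReal.ofReal_le_ofReal (le_of_eq ?_)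
    have e2 : ((k : ℝ) + 1) / 2 ^ n - (k : ℝ) / 2 ^ n = 1 / 2 ^ n := by ring
    obtain ⟨j, rfl⟩ : ∃ j, m = j + 2 := ⟨m - 2, by omega⟩
    have e3 : ((1 : ℝ) / 4) ^ n = 1 / (2 ^ n * 2 ^ n) := by
      rw [← mul_pow, one_div_pow]; norm_num
    rw [e2, abs_of_pos (by positivity), add_tsub_cancel_right, pow_mul, e3, one_div_pow, pow_add]
    field_simp
  have hsum := ae_tsum_lt_top (P := P) (f := fun n ω => ∑ k ∈ I n, F n k ω)
    (A := (2 * N + 1) * C) (fun n => Finset.aemeasurable_fun_sum _ fun k _ => hFm n k) (by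
      intro n
      rw [lintegral_finsetSum' _ fun k _ => hFm n k]
      refine (Finset.sum_le_sum fun k _ => hFi n k).trans ?_
      rw [Finset.sum_const, nsmul_eq_mul, ← ENNReal.ofReal_natCast, ← ENNReal.ofReal_mul (by positivity)]
      refine ENNReal.ofReal_le_ofReal ?_
      have hcard : ((I n).card : ℝ) = 2 * N * 2 ^ n + 1 := by
        rw [hI, Int.card_Icc, ← Int.cast_natCast (R := ℝ), Int.toNat_of_nonneg (by linarith [Int.natCast_nonneg (N * 2 ^ n)])]
        push_cast
        ring
      rw [hcard, show (1 / 4 : ℝ) = 1 / 2 * (1 / 2) by norm_num, mul_pow]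
      have e1 : (2 : ℝ) ^ n * (1 / 2) ^ n = 1 := by rw [← mul_pow]; norm_num
      have e2 : (1 / 2 : ℝ) ^ n ≤ 1 := pow_le_one₀ (by norm_num) (by norm_num)
      have e3 : 0 ≤ C * (1 / 2 : ℝ) ^ n := by positivity
      have e4 : (2 * (N : ℝ) * 2 ^ n + 1) * (C * ((1 / 2) ^ n * (1 / 2) ^ n)) =
          (2 * N * (2 ^ n * (1 / 2) ^ n) + (1 / 2) ^ n) * (C * (1 / 2) ^ n) := by ring
      rw [e4, e1, mul_one, mul_assoc]
      gcongr)
  filter_upwards [hsum] with ω hω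
  refine ⟨(∑' n, ∑ k ∈ I n, F n k ω).toReal, ENNReal.toReal_nonneg, fun n k hk => ?_⟩
  have h1 : F n k ω ≤ ∑' n, ∑ k ∈ I n, F n k ω :=
    (Finset.single_le_sum (f := fun k => F n k ω) (fun _ _ => zero_le) hk).trans
      (ENNReal.le_tsum (f := fun n => ∑ k ∈ I n, F n k ω) n)
  have h2 := ENNReal.toReal_mono hω.ne h1
  rwa [ENNReal.toReal_ofReal (by positivity)] at h2

theorem exists_dyadicBound {z : ℝ → ℝ} {N : ℕ}
    (h : ∀ m : ℕ, 2 ≤ m → ∃ K, 0 ≤ K ∧ ∀ (n : ℕ) (k : ℤ),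
      k ∈ Finset.Icc (-((N * 2 ^ n : ℕ) : ℤ)) ((N * 2 ^ n : ℕ) : ℤ) →
      |z (((k : ℝ) + 1) / 2 ^ n) - z ((k : ℝ) / 2 ^ n)| ^ (2 * m) * 2 ^ (n * (m - 2)) ≤ K)
    {α : ℝ} (hα : α < 1 / 2) : ∃ K, 0 ≤ K ∧ DyadicBound z N K ((1 / 2) ^ α) := by
  -- The moment of order `2m` yields the exponent `(m - 2) / (2m) = 1/2 - 1/m`, which is at least
  -- `α` once `m ≥ 1 / (1/2 - α)`.
  obtain ⟨m, hm⟩ := exists_nat_gt (max 2 (1 / (1 / 2 - α)))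
  have hm2 : (2 : ℝ) < m := (le_max_left _ _).trans_lt hm
  have hmα : 1 / (1 / 2 - α) < m := (le_max_right _ _).trans_lt hm
  have hm2' : 2 < m := by exact_mod_cast hm2
  obtain ⟨K, hK, hb⟩ := h m hm2'.le
  refine ⟨K ^ ((2 * m : ℕ) : ℝ)⁻¹, by positivity, fun n k hk => ?_⟩
  have h1 := hb n k hk
  set d := |z (((k : ℝ) + 1) / 2 ^ n) - z ((k : ℝ) / 2 ^ n)| with hd
  have hd0 : 0 ≤ d := abs_nonneg _
  have hα' : 0 < 1 / 2 - α := by linarith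
  rw [div_lt_iff₀ hα'] at hmα
  have hg0 : (0 : ℝ) < (1 / 2) ^ α := by positivity
  refine le_of_pow_le_pow_left₀ (n := 2 * m) (by omega) (by positivity) ?_
  rw [mul_pow, Real.rpow_inv_natCast_pow hK (by omega)]
  have h2 : ((1 / 2 : ℝ) ^ (n * (m - 2))) ≤ (((1 / 2 : ℝ) ^ α) ^ n) ^ (2 * m) := by
    have e : (((1 / 2 : ℝ) ^ α) ^ n) ^ (2 * m) = (1 / 2 : ℝ) ^ (α * (n * (2 * m) : ℕ)) := by
      rw [← pow_mul, ← Real.rpow_natCast, ← Real.rpow_mul (by norm_num)]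
    rw [e, ← Real.rpow_natCast]
    refine Real.rpow_le_rpow_of_exponent_ge (by norm_num) (by norm_num) ?_
    push_cast [Nat.cast_sub hm2'.le]
    have hn : (0 : ℝ) ≤ n := by positivity
    have : α * (2 * m) ≤ m - 2 := by nlinarith
    calc α * (n * (2 * m)) = n * (α * (2 * m)) := by ring
      _ ≤ n * (m - 2) := by gcongr
  have h3 : d ^ (2 * m) ≤ K * (1 / 2 : ℝ) ^ (n * (m - 2)) := by
    rw [one_div_pow, mul_one_div, le_div_iff₀ (by positivity)]
    exact h1
  refine h3.trans ?_
  gcongr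

theorem holderOnWith_of_dist_le {f : ℝ → ℝ} {s : Set ℝ} {C : ℝ} (hC : 0 ≤ C) {α : NNReal}
    (h : ∀ u ∈ s, ∀ v ∈ s, dist (f u) (f v) ≤ C * dist u v ^ (α : ℝ)) :
    HolderOnWith C.toNNReal α f s := by
  intro u hu v hv
  rw [edist_dist, edist_dist, ENNReal.ofReal_rpow_of_nonneg dist_nonneg α.coe_nonneg]
  refine (ENNReal.ofReal_le_ofReal (h u hu v hv)).trans ?_
  rw [ENNReal.ofReal_mul hC]
  rfl

/-- **Kolmogorov–Chentsov**: a real process whose increments have all Gaussian type moments has a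
version with locally Hölder continuous paths of every order below `1 / 2`. -/
theorem exists_locally_holder_version {Z : ℝ → Ω → ℝ} (hZ : ∀ u, AEMeasurable (Z u) P)
    (h : ∀ m : ℕ, ∃ C, 0 ≤ C ∧ ∀ u v, ∫⁻ ω, ENNReal.ofReal (|Z u ω - Z v ω| ^ (2 * m)) ∂P ≤
      ENNReal.ofReal (C * |u - v| ^ m)) :
    ∃ Y : ℝ → Ω → ℝ, (∀ u, Measurable (Y u)) ∧ (∀ u, Y u =ᵐ[P] Z u) ∧
      ∀ ω, ∀ α : NNReal, 0 < α → α < 1 / 2 → ∀ a b : ℝ, ∃ C : NNReal,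
        HolderOnWith C α (fun u => Y u ω) (Set.Icc a b) := by
  choose C hC0 hC using h
  -- One almost sure event serves all `N` and `m`, so that the version does not depend on the
  -- exponent or on the interval.
  have hgood : ∀ᵐ ω ∂P, ∀ (N m : ℕ), 2 ≤ m → ∃ K, 0 ≤ K ∧ ∀ (n : ℕ) (k : ℤ),
      k ∈ Finset.Icc (-((N * 2 ^ n : ℕ) : ℤ)) ((N * 2 ^ n : ℕ) : ℤ) →
      |(hZ (((k : ℝ) + 1) / 2 ^ n)).mk _ ω - (hZ ((k : ℝ) / 2 ^ n)).mk _ ω| ^ (2 * m) *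
        2 ^ (n * (m - 2)) ≤ K := by
    rw [ae_all_iff]; intro N
    rw [ae_all_iff]; intro m
    by_cases hm : 2 ≤ m
    · have hmk : ∀ᵐ ω ∂P, ∀ (n : ℕ) (k : ℤ), Z ((k : ℝ) / 2 ^ n) ω = (hZ ((k : ℝ) / 2 ^ n)).mk _ ω := by
        rw [ae_all_iff]; intro n
        rw [ae_all_iff]; intro k
        exact (hZ _).ae_eq_mk
      filter_upwards [ae_exists_bound_increment hZ hm (hC0 m) (hC m) N, hmk] with ω hω hω' _
      obtain ⟨K, hK, hb⟩ := hω
      refine ⟨K, hK, fun n k hk => ?_⟩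
      have := hb n k hk
      have e := hω' n (k + 1)
      push_cast at e
      rwa [e, hω'] at this
    · exact Eventually.of_forall fun _ h => absurd h hm
  obtain ⟨G, hGm, hGP, hG⟩ : ∃ G : Set Ω, MeasurableSet G ∧ (∀ᵐ ω ∂P, ω ∈ G) ∧
      ∀ ω ∈ G, ∀ (N m : ℕ), 2 ≤ m → ∃ K, 0 ≤ K ∧ ∀ (n : ℕ) (k : ℤ),
        k ∈ Finset.Icc (-((N * 2 ^ n : ℕ) : ℤ)) ((N * 2 ^ n : ℕ) : ℤ) →
        |(hZ (((k : ℝ) + 1) / 2 ^ n)).mk _ ω - (hZ ((k : ℝ) / 2 ^ n)).mk _ ω| ^ (2 * m) *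
          2 ^ (n * (m - 2)) ≤ K := by
    obtain ⟨G, hsub, hm, hP⟩ := exists_measurable_superset_of_null (ae_iff.1 hgood)
    refine ⟨Gᶜ, hm.compl, by rw [ae_iff]; simpa using hP, fun ω hω => ?_⟩
    by_contra hcon
    exact hω (hsub hcon)
  -- Outside the good event the paths are set to `0`, so that the dyadic bounds hold for every `ω`.
  set Z' : ℝ → Ω → ℝ := fun u => G.indicator ((hZ u).mk _) with hZ'
  have hbound : ∀ ω (N : ℕ) (α : ℝ), α < 1 / 2 →
      ∃ K, 0 ≤ K ∧ DyadicBound (fun u => Z' u ω) N K ((1 / 2) ^ α) := by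
    intro ω N α hα
    by_cases hω : ω ∈ G
    · refine exists_dyadicBound (fun m hm => ?_) hα
      simpa only [hZ', Set.indicator_of_mem hω] using hG ω hω N m hm
    · refine ⟨0, le_rfl, fun n k _ => ?_⟩
      simp [hZ', hω]
  have hlim : ∀ u ω, ∃ y, Tendsto (fun n => Z' (dyadicFloor n u) ω) atTop (𝓝 y) := by
    intro u ω
    obtain ⟨N, hN⟩ := exists_nat_ge |u|
    -- Any exponent in `(0, 1/2)` would do here, since only the existence of the limit is needed.
    obtain ⟨K, hK, hb⟩ := hbound ω N (1 / 4) (by norm_num)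
    exact hb.exists_tendsto hK (by positivity)
      (Real.rpow_lt_one (by norm_num) (by norm_num) (by norm_num)) (abs_le.1 hN)
  choose Y hY using hlim
  have hZ'm : ∀ u, Measurable (Z' u) := fun u => (hZ u).measurable_mk.indicator hGm
  refine ⟨Y, fun u => ?_, fun u => ?_, fun ω α hα hα2 a b => ?_⟩
  · exact measurable_of_tendsto_metrizable (fun n => hZ'm (dyadicFloor n u))
      (tendsto_pi_nhds.2 fun ω => hY u ω)
  -- Second moments (`m = 1`) suffice for `Y u = Z u` almost surely: those of the differences
  -- between `Z u` and its dyadic approximations are summable.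
  · have h1 := ae_tsum_lt_top (P := P)
      (f := fun n ω => ENNReal.ofReal (|Z (dyadicFloor n u) ω - Z u ω| ^ (2 * 1))) (A := C 1)
      (fun n => ((((hZ (dyadicFloor n u)).sub (hZ u)).norm).pow_const _).ennreal_ofReal) (by
        intro n
        refine (hC 1 _ _).trans (ENNReal.ofReal_le_ofReal ?_)
        rw [pow_one]
        have := hC0 1
        gcongr
        exact abs_sub_dyadicFloor_le n u)
    have h2 : ∀ᵐ ω ∂P, ∀ n, Z (dyadicFloor n u) ω = Z' (dyadicFloor n u) ω := by
      rw [ae_all_iff]; intro n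
      filter_upwards [(hZ (dyadicFloor n u)).ae_eq_mk, hGP] with ω h3 h4
      rw [h3, hZ']
      simp [h4]
    filter_upwards [h1, h2] with ω h3 h4
    have h5 := ENNReal.tendsto_atTop_zero_of_tsum_ne_top h3.ne
    have h6 : Tendsto (fun n => |Z' (dyadicFloor n u) ω - Z u ω| ^ (2 * 1)) atTop (𝓝 0) := by
      have := (ENNReal.tendsto_toReal ENNReal.zero_ne_top).comp h5
      refine this.congr fun n => ?_
      simp only [Function.comp_apply, h4 n]
      exact ENNReal.toReal_ofReal (by positivity)
    have h7 : Tendsto (fun n => |Z' (dyadicFloor n u) ω - Z u ω| ^ (2 * 1)) atTop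
        (𝓝 (|Y u ω - Z u ω| ^ (2 * 1))) := (((hY u ω).sub_const _).abs).pow _
    have h8 := tendsto_nhds_unique h7 h6
    have h9 := pow_eq_zero_iff (by norm_num) |>.1 h8
    exact sub_eq_zero.1 (abs_eq_zero.1 h9)
  · obtain ⟨N, hN⟩ := exists_nat_ge (max |a| |b|)
    have hsub : Set.Icc a b ⊆ Set.Icc (-(N : ℝ)) N := by
      refine Set.Icc_subset_Icc ?_ ?_
      · linarith [neg_abs_le a, (le_max_left |a| |b|).trans hN]
      · linarith [le_abs_self b, (le_max_right |a| |b|).trans hN]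
    have hα2' : (α : ℝ) < 1 / 2 := by exact_mod_cast hα2
    obtain ⟨K, hK, hb⟩ := hbound ω N α hα2'
    obtain ⟨D, hD, hd⟩ := hb.exists_holder (α : ℝ) (by exact_mod_cast hα) hK
      (y := fun u => Y u ω) (fun u _ => hY u ω)
    exact ⟨D.toNNReal, holderOnWith_of_dist_le hD fun u hu v hv => hd u (hsub hu) v (hsub hv)⟩

/-- Scaling by `√v` reduces to the standard normal law, whose moment of order `2m` is the constant
`C`. -/
theorem exists_lintegral_pow_gaussianReal_le (m : ℕ) : ∃ C, 0 ≤ C ∧ ∀ v : NNReal,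
    ∫⁻ x, ENNReal.ofReal (|x| ^ (2 * m)) ∂(gaussianReal 0 v) ≤ ENNReal.ofReal (C * v ^ m) := by
  have hfin : ∫⁻ x, ENNReal.ofReal (|x| ^ (2 * m)) ∂(gaussianReal 0 1) ≠ ⊤ := by
    have h := (memLp_id_gaussianReal' (μ := 0) (v := 1) ((2 * m : ℕ) : ENNReal)
      (ENNReal.natCast_ne_top _)).integrable_norm_pow'
    exact h.lintegral_lt_top.ne
  refine ⟨(∫⁻ x, ENNReal.ofReal (|x| ^ (2 * m)) ∂(gaussianReal 0 1)).toReal,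
    ENNReal.toReal_nonneg, fun v => ?_⟩
  have hmap : gaussianReal 0 v = (gaussianReal 0 1).map (Real.sqrt v * ·) := by
    rw [gaussianReal_map_const_mul, mul_zero, mul_one]
    congr 1
    ext
    simp
  rw [hmap, lintegral_map (by fun_prop) (by fun_prop)]
  have e : ∀ x : ℝ, ENNReal.ofReal (|Real.sqrt v * x| ^ (2 * m)) =
      ENNReal.ofReal ((v : ℝ) ^ m) * ENNReal.ofReal (|x| ^ (2 * m)) := by
    intro x
    rw [← ENNReal.ofReal_mul (by positivity), abs_mul, mul_pow, abs_of_nonneg (Real.sqrt_nonneg _),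
      pow_mul (Real.sqrt v), Real.sq_sqrt v.coe_nonneg]
  simp only [e]
  rw [lintegral_const_mul' _ _ ENNReal.ofReal_ne_top, mul_comm (ENNReal.toReal _),
    ENNReal.ofReal_mul (by positivity), ENNReal.ofReal_toReal hfin]

end Modification

end

/-! ### Covariances and increments of the processes, and the main theorem. -/

noncomputable section

section Processes

variable {Ω : Type*} [MeasurableSpace Ω] {P : Measure Ω}
  {W : Set (ℝ × (ℕ → unitInterval)) → Ω → ℝ}

theorem IsWhiteNoise.integral_procZ_mul (hW : IsWhiteNoise W intensity P) {l : ℕ} (hl : 1 ≤ l)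
    (n : ℕ) (u v : ℝ) :
    ∫ ω, procZ W P l u ω * procZ W P (l + n) v ω ∂P = crossCovZ l n u v := by
  rw [(hW.isIntegral_procZ hl u).integral_mul hW (hW.isIntegral_procZ (by omega) v), ← integral_tailKernel_mul_add hl]
  exact integral_congr_ae (Eventually.of_forall fun z => by ring)

theorem crossCovZ_zero (l : ℕ) (u v : ℝ) : crossCovZ l 0 u v = covZ l u v := by
  simp [crossCovZ]

theorem covZ_add_right (l : ℕ) (u v h : ℝ) : covZ l (u + h) (v + h) = covZ l u v := by
  simp [covZ]

theorem IsWhiteNoise.integral_procZ_mul_self (hW : IsWhiteNoise W intensity P) {l : ℕ}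
    (hl : 1 ≤ l) (u v : ℝ) :
    ∫ ω, procZ W P l u ω * procZ W P l v ω ∂P = covZ l u v := by
  simpa only [crossCovZ_zero, add_zero] using hW.integral_procZ_mul hl 0 u v

theorem IsWhiteNoise.map_procZ_sub [IsProbabilityMeasure P] (hW : IsWhiteNoise W intensity P)
    {l : ℕ} (hl : 1 ≤ l) (u v : ℝ) :
    ∃ s : NNReal, (s : ℝ) ≤ |u - v| ∧
      P.map (fun ω => procZ W P l u ω - procZ W P l v ω) = gaussianReal 0 s := by
  have h : IsWhiteNoiseIntegral W intensity P _
      (fun ω => procZ W P l u ω + -1 * procZ W P l v ω) :=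
    (hW.isIntegral_procZ hl u).add hW ((hW.isIntegral_procZ hl v).const_mul (-1))
  have e : (fun ω => procZ W P l u ω + -1 * procZ W P l v ω) =
      fun ω => procZ W P l u ω - procZ W P l v ω := funext fun ω => by ring
  refine ⟨_, ?_, e ▸ h.map_eq hW⟩
  rw [Real.coe_toNNReal _ (integral_nonneg fun _ => sq_nonneg _), ← h.integral_sq hW]
  refine le_trans (le_of_eq ?_) (covZ_increment_le hl u v)
  rw [integral_add_sq (hW.isIntegral_procZ hl u).2.1 ((hW.isIntegral_procZ hl v).const_mul (-1)).2.1]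
  have e1 := hW.integral_procZ_mul_self hl u u
  have e2 := hW.integral_procZ_mul_self hl v v
  have e3 := hW.integral_procZ_mul_self hl u v
  simp only [← sq] at e1 e2
  simp only [mul_pow, mul_left_comm _ (-1 : ℝ), integral_const_mul, e1, e2, e3]
  ring

end Processes

end

theorem theorem1p8 {Ω : Type*} [MeasurableSpace Ω] (P : Measure Ω) [IsProbabilityMeasure P]
    (W : Set (ℝ × (ℕ → unitInterval)) → Ω → ℝ) (hW : IsWhiteNoise W intensity P) :
    -- the processes are jointly Gaussian
    IsGaussianProcess (fun p : ℕ+ × ℝ => procZ W P (p.1 : ℕ) p.2) P ∧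
    (∀ l : ℕ, 1 ≤ l →
      -- each of them is a centered stationary Gaussian process with the stated covariance
      IsGaussianProcess (procZ W P l) P ∧
      (∀ u : ℝ, ∫ ω, procZ W P l u ω ∂P = 0) ∧
      IsStrictlyStationary (procZ W P l) P ∧
      (∀ u v : ℝ, cov[procZ W P l u, procZ W P l v; P] = covZ l u v) ∧
      -- cross-covariances
      (∀ (n : ℕ) (u v : ℝ),
        ∫ ω, procZ W P l u ω * procZ W P (l + n) v ω ∂P = crossCovZ l n u v) ∧
      -- a version with locally Hölder continuous paths, of every order in `(0, 1/2)`
      ∃ Y : ℝ → Ω → ℝ, (∀ u, Measurable (Y u)) ∧ (∀ u, Y u =ᵐ[P] procZ W P l u) ∧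
        ∀ ω, ∀ α : NNReal, 0 < α → α < 1 / 2 → ∀ a b : ℝ, ∃ C : NNReal,
          HolderOnWith C α (fun u => Y u ω) (Set.Icc a b)) := by
  refine ⟨IsWhiteNoiseIntegral.isGaussianProcess hW fun p : ℕ+ × ℝ => hW.isIntegral_procZ p.1.2 p.2,
    fun l hl => ⟨IsWhiteNoiseIntegral.isGaussianProcess hW (hW.isIntegral_procZ hl),
      fun u => (hW.isIntegral_procZ hl u).integral_eq_zero hW, fun n t h => ?_, fun u v => ?_,
      hW.integral_procZ_mul hl, ?_⟩⟩
  -- Stationarity: the Gram matrix of the integrands is given by `covZ`, which is invariant under a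
  -- common shift of both times.
  · refine IsWhiteNoiseIntegral.identDistrib hW (fun i => hW.isIntegral_procZ hl (t i + h))
      (fun i => hW.isIntegral_procZ hl (t i)) fun i j => ?_
    rw [← (hW.isIntegral_procZ hl (t i + h)).integral_mul hW (hW.isIntegral_procZ hl (t j + h)),
      ← (hW.isIntegral_procZ hl (t i)).integral_mul hW (hW.isIntegral_procZ hl (t j)),
      hW.integral_procZ_mul_self hl, hW.integral_procZ_mul_self hl, covZ_add_right]
  · rw [covariance_eq_sub (hW.isIntegral_procZ hl u).2.1 (hW.isIntegral_procZ hl v).2.1,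
      (hW.isIntegral_procZ hl u).integral_eq_zero hW, zero_mul, sub_zero]
    exact hW.integral_procZ_mul_self hl u v
  · have hm := fun u => (hW.isIntegral_procZ hl u).2.1.aestronglyMeasurable.aemeasurable
    refine exists_locally_holder_version hm fun m => ?_
    obtain ⟨C, hC, hb⟩ := exists_lintegral_pow_gaussianReal_le m
    refine ⟨C, hC, fun u v => ?_⟩
    obtain ⟨s, hs, hmap⟩ := hW.map_procZ_sub hl u v
    have h := hb s
    have hsub : AEMeasurable (fun ω => procZ W P l u ω - procZ W P l v ω) P := (hm u).sub (hm v)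
    rw [← hmap, lintegral_map' (by fun_prop) hsub] at h
    refine h.trans (ENNReal.ofReal_le_ofReal ?_)
    gcongr
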